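/- Let $\mathcal U,\mathcal V,\mathcal X,\mathcal Y$ be finite alphabets, where $\mathcal X$ has at least two elements, one of which is a distinguished symbol $0$. Let $P_{UV},Q_{UV}$ be pmfs on $\mathcal U\times\mathcal V$ with $Q_{UV}(u,v)>0$ for all $(u,v)$, with marginals $P_U,P_V,Q_U,Q_V$. Let $\Gamma(y|x)$ be the transition law of a discrete memoryless channel (DMC) from $\mathcal X$ to $\mathcal Y$. Let $c:\mathcal X\to[0,\infty)$ satisfy $c(x)=0$ if and only if $x=0$. Let $C_n\ge 0$ ($n\ge1$) be real numbers with $C_n\to\infty$ and $C_n/n\to0$. Under hypothesis $\mathcal H=0$ (respectively $\mathcal H=1$) the pairs $(U_i,V_i)$, $i=1,\dots,n$, are i.i.d. with pmf $P_{UV}$ (respectively $Q_{UV}$). A code of blocklength $n$ is a pair of functions $f^{(n)}:\mathcal U^n\to\mathcal X^n$ and $g^{(n)}:\mathcal V^n\times\mathcal Y^n\to\{0,1\}$. The channel input is $X^n=f^{(n)}(U^n)$, the output $Y^n$ is obtained from $X^n$ by $n$ uses of the DMC, with $\Pr[Y^n=y^n\mid U^n,V^n]=\prod_{i=1}^n\Gamma(y_i|X_i)$,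 and the decision is $\hat{\mathcal H}=g^{(n)}(V^n,Y^n)$. Put $\alpha_n=\Pr[\hat{\mathcal H}=1\mid\mathcal H=0]$ and $\beta_n=\Pr[\hat{\mathcal H}=0\mid\mathcal H=1]$. Given $\epsilon\in[0,1)$, an exponent $\theta>0$ is $\epsilon$-achievable under the expected cost constraint imposed under a set of hypotheses if there are codes $(f^{(n)},g^{(n)})_{n\ge1}$ such that $\sum_{i=1}^n\mathbb E[c(X_i)\mid\mathcal H=\mathsf H]\le C_n$ for all $n\ge1$ and all hypotheses $\mathsf H$ in that set, $\limsup_{n\to\infty}\alpha_n\le\epsilon$, and $\liminf_{n\to\infty}-\frac1n\log\beta_n\ge\theta$ (with $-\log0=+\infty$). Let $\theta^\star_{\mathcal H=0}(\epsilon,\{C_n\})$ and $\theta^\star_{\mathrm{both}}(\epsilon,\{C_n\})$ be the supremum in $[0,\infty]$ of all $\epsilon$-achievable exponents (with $\sup\emptyset=0$) when the constraint is imposed only under $\mathsf H=0$, and under both $\mathsf H=0$ and $\mathsf H=1$, respectively. With $D(\cdot\|\cdot)$ denoting relative entropy, taken with the same logarithm as above, and the minima ranging over pmfs $\pi_{UV}$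 on $\mathcal U\times\mathcal V$ with marginals $\pi_U,\pi_V$, define $$E_1=\min_{\pi_{UV}:\ \pi_U=P_U,\ \pi_V=P_V}D(\pi_{UV}\|Q_{UV}),\qquad E_3=\min_{\pi_{UV}:\ \pi_U=Q_U,\ \pi_V=P_V}D(\pi_{UV}\|Q_{UV}),$$ $$E_2=D(P_V\|Q_V)+\max_{\hat x\in\mathcal X\setminus\{0\}}D\big(\Gamma(\cdot|0)\,\|\,\Gamma(\cdot|\hat x)\big).$$ Then for every $\epsilon\in[0,1)$ the following holds. 1. If there are $x_0,x_1\in\mathcal X$ and $y^*\in\mathcal Y$ with $\Gamma(y^*|x_0)>0$ and $\Gamma(y^*|x_1)=0$ (a partially connected DMC), then $\theta^\star_{\mathrm{both}}(\epsilon,\{C_n\})=\theta^\star_{\mathcal H=0}(\epsilon,\{C_n\})=E_1$. 2. If no such triple exists (a fully connected DMC), then $\theta^\star_{\mathcal H=0}(\epsilon,\{C_n\})=\min\{E_1,E_2\}$ and $\theta^\star_{\mathrm{both}}(\epsilon,\{C_n\})=\min\{E_1,E_2,E_3\}$. -/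

import Mathlib

open Filter
open scoped ENNReal BigOperators

/-! Probability mass functions on a finite alphabet `α` are the elements of `stdSimplex ℝ α`. -/

noncomputable section

namespace DistDetect

section Divergence

variable {α : Type*} [Fintype α]

/-- Relative entropy `D(p‖q)` (natural logarithm) of two pmfs on a finite alphabet, with the usual
conventions: a term with `p a = 0` contributes `0`, and the value is `+∞` when the support of `p`
is not included in the support of `q`. -/
def relEntropy (p q : α → ℝ) : ℝ≥0∞ :=
  open Classical in
  if ∀ a, q a = 0 → p a = 0 then ENNReal.ofReal (∑ a, p a * Real.log (p a / q a)) else ⊤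

end Divergence

section Marginals

variable {U V : Type*} [Fintype U] [Fintype V]

/-- The first marginal of a pmf on `U × V`. -/
def margU (p : U × V → ℝ) : U → ℝ := fun u => ∑ v, p (u, v)

/-- The second marginal of a pmf on `U × V`. -/
def margV (p : U × V → ℝ) : V → ℝ := fun v => ∑ u, p (u, v)

/-- The minimum of `D(π‖Q)` over all pmfs `π` on `U × V` with first marginal `a` and second
marginal `b`. -/
def minDivergence (a : U → ℝ) (b : V → ℝ) (Q : U × V → ℝ) : ℝ≥0∞ :=
  ⨅ π ∈ {π : U × V → ℝ | π ∈ stdSimplex ℝ (U × V) ∧ margU π = a ∧ margV π = b}, relEntropy π Q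

end Marginals

section System

variable {U V X Y : Type*} [Fintype U] [Fintype V] [Fintype Y]

/-- Probability of the decision `h` at blocklength `n` when `(U^n, V^n)` is i.i.d. with pmf `R`,
the channel input is `X^n = f(U^n)`, the channel output `Y^n` is produced by the memoryless channel
`Γ` (`Γ x y` is the probability of output `y` given input `x`), and the decision is
`g(V^n, Y^n)`. -/
def decisionProb (R : U × V → ℝ) (Γ : X → Y → ℝ) {n : ℕ} (f : (Fin n → U) → (Fin n → X))
    (g : (Fin n → V) → (Fin n → Y) → Fin 2) (h : Fin 2) : ℝ :=
  ∑ u : Fin n → U, ∑ v : Fin n → V, ∑ y : Fin n → Y,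
    if g v y = h then (∏ i, R (u i, v i)) * ∏ i, Γ (f u i) (y i) else 0

/-- Expected cost `∑ i, E[c(X_i)]` when `(U^n, V^n)` is i.i.d. with pmf `R` and `X^n = f(U^n)`. -/
def expectedCost (R : U × V → ℝ) (c : X → ℝ) {n : ℕ} (f : (Fin n → U) → (Fin n → X)) : ℝ :=
  ∑ i, ∑ u : Fin n → U, ∑ v : Fin n → V, (∏ j, R (u j, v j)) * c (f u i)

/-- The miss-detection exponent `θ` is `ε`-achievable when the expected cost constraint `C` is
imposed under every hypothesis in `S`. `P` is the source pmf under hypothesis `0` and `Q` the one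
under hypothesis `1`. The exponent of a vanishing miss-detection probability is `+∞`. -/
def Achievable (P Q : U × V → ℝ) (Γ : X → Y → ℝ) (c : X → ℝ) (C : ℕ → ℝ) (S : Set (Fin 2))
    (ε θ : ℝ) : Prop :=
  ∃ (f : ∀ n : ℕ, (Fin n → U) → (Fin n → X)) (g : ∀ n : ℕ, (Fin n → V) → (Fin n → Y) → Fin 2),
    (∀ n : ℕ, 1 ≤ n → ∀ h ∈ S, expectedCost (![P, Q] h) c (f n) ≤ C n) ∧
    limsup (fun n : ℕ => decisionProb P Γ (f n) (g n) 1) atTop ≤ ε ∧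
    (θ : EReal) ≤ liminf (fun n : ℕ => ((-(1 / (n : ℝ)) : ℝ) : EReal) *
      ENNReal.log (ENNReal.ofReal (decisionProb Q Γ (f n) (g n) 0))) atTop

/-- The Stein exponent: supremum, in `[0, ∞]`, of the `ε`-achievable exponents `θ > 0`, when the
expected cost constraint `C` is imposed under every hypothesis in `S`. -/
def steinExponent (P Q : U × V → ℝ) (Γ : X → Y → ℝ) (c : X → ℝ) (C : ℕ → ℝ) (S : Set (Fin 2))
    (ε : ℝ) : ℝ≥0∞ :=
  ⨆ θ ∈ {θ : ℝ | 0 < θ ∧ Achievable P Q Γ c C S ε θ}, ENNReal.ofReal θ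

/-- Some output can be induced by one input but not by another one. -/
def PartiallyConnected (Γ : X → Y → ℝ) : Prop :=
  ∃ (x₀ x₁ : X) (y : Y), 0 < Γ x₀ y ∧ Γ x₁ y = 0

/-- `E₁`: the minimum of `D(π‖Q)` subject to `π_U = P_U` and `π_V = P_V`. -/
def exponentE1 (P Q : U × V → ℝ) : ℝ≥0∞ := minDivergence (margU P) (margV P) Q

/-- `E₂ = D(P_V‖Q_V) + max_{x ≠ 0} D(Γ(·|0)‖Γ(·|x))`. -/
def exponentE2 [Zero X] (P Q : U × V → ℝ) (Γ : X → Y → ℝ) : ℝ≥0∞ :=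
  relEntropy (margV P) (margV Q) + ⨆ x ∈ {x : X | x ≠ 0}, relEntropy (Γ 0) (Γ x)

/-- `E₃`: the minimum of `D(π‖Q)` subject to `π_U = Q_U` and `π_V = P_V`. -/
def exponentE3 (P Q : U × V → ℝ) : ℝ≥0∞ := minDivergence (margU Q) (margV P) Q

end System

end DistDetect

end

/-! The exponents are bounded on both sides by single-letter inequalities that tensorize, so that no
counting of types is needed.

*The minimal divergence.* Let `E` be the minimum of `D(π‖Q)` over laws with marginals `a`, `b`.
By Lagrangian duality (`exists_dual_potentials`, a separation argument), there are functions `φ`,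
`ψ` with `log ∑ Q exp (φ + ψ) ≤ ∑ a φ + ∑ b ψ - E + η`. A Chernoff bound then shows that under `Q` the
event "`u` is typical for `a` and `v` is typical for `b`", expressed by the empirical means of `φ`
and `ψ`, has probability at most `exp (-n (E - O(η)))`. Conversely
(`exists_reverse_hypercontractive`), for some power `K` and all nonnegative `f`, `g`,
`∑ Q f ^ K g ^ K ≥ exp (-(E + η)) (∑ a f) ^ K (∑ b g) ^ K`. This inequality passes to words
(`reverse_hypercontractive_iid`) and shows that a set of probability at least `exp (-o(n))` under `a`
and one of probability at least `exp (-o(n))` under `b` are hit simultaneously under `Q` with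
probability at least `exp (-n (E + o(1)))`. This plays the role of a blowing-up lemma and yields
the strong converse.

*Converse.* There are `exp (o(n))` words of cost `o(n)`, so by Markov's inequality and the
pigeonhole principle some codeword `x` is sent and accepted with probability `exp (-o(n))` under
hypothesis `0`. Reverse hypercontractivity, applied to the source words mapped to `x` and to the
acceptance probability of `x`, bounds the exponent by `E₁`. On a fully connected channel cheap
codewords are interchangeable with the zero word up to a factor `exp (o(n))`
(`exists_channel_comparison`). A cost constraint under hypothesis `1` makes some cheap codeword
frequent under `Q_U`, which gives `E₃`. Changing the measure so that `V` is i.i.d. `P_V` and the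
channel always sees the zero word (`exists_change_of_measure`) gives `E₂`, whether or not the cost
is constrained under hypothesis `1`.

*Achievability.* All codes have two codewords, for typical and atypical `u`, and accept on a
rectangle of pairs `(v, y)`. On a partially connected channel a slowly growing number of uses
signals typicality with no error in the direction that matters. On a fully connected one, silence
signals that `u` is typical for a constrained hypothesis, and a costly symbol is repeated
throughout otherwise. -/

namespace DistDetect

/-! ### Relative entropy as a real number -/

section Divergence

variable {α : Type*} [Fintype α]

/-- The sum `∑ p log (p / q)` as a real number. It is the relative entropy when the support of `p`
is contained in that of `q`; it is also used for weights `q` that are not normalized. -/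
noncomputable def klReal (p q : α → ℝ) : ℝ := ∑ a, p a * Real.log (p a / q a)

theorem relEntropy_eq_ofReal {p q : α → ℝ} (h : ∀ a, q a = 0 → p a = 0) :
    relEntropy p q = ENNReal.ofReal (klReal p q) := by
  simp only [relEntropy, klReal, if_pos h]

/-- Gibbs' inequality for an unnormalized reference weight. -/
theorem neg_log_sum_le_klReal {p w : α → ℝ} (hp : p ∈ stdSimplex ℝ α) (hw : ∀ a, 0 ≤ w a)
    (hac : ∀ a, w a = 0 → p a = 0) : -Real.log (∑ a, w a) ≤ klReal p w := by
  obtain ⟨hp0, hp1⟩ := hp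
  have hZ : 0 < ∑ a, w a := by
    refine lt_of_le_of_ne (Finset.sum_nonneg fun a _ => hw a) fun h => ?_
    have := (Finset.sum_eq_zero_iff_of_nonneg fun a _ => hw a).1 h.symm
    have h0 : ∑ a, p a = 0 := Finset.sum_eq_zero fun a ha => hac a (this a ha)
    linarith
  set Z := ∑ a, w a with hZdef
  have key : ∀ a, p a * (-Real.log Z) + (p a - w a / Z) ≤ p a * Real.log (p a / w a) := by
    intro a
    rcases (hp0 a).eq_or_lt with h | h
    · rw [← h]
      have : 0 ≤ w a / Z := div_nonneg (hw a) hZ.le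
      simp; exact this
    · have hwa : 0 < w a := lt_of_le_of_ne (hw a) fun h' => h.ne' (hac a h'.symm)
      have h1 := Real.log_le_sub_one_of_pos (x := w a / (p a * Z)) (by positivity)
      rw [Real.log_div hwa.ne' (by positivity), Real.log_mul h.ne' hZ.ne'] at h1
      rw [Real.log_div h.ne' hwa.ne']
      have h2 := mul_le_mul_of_nonneg_left h1 h.le
      have h3 : p a * (w a / (p a * Z) - 1) = w a / Z - p a := by field_simp
      rw [h3] at h2
      linarith
  have := Finset.sum_le_sum fun a (_ : a ∈ Finset.univ) => key a
  rw [Finset.sum_add_distrib, ← Finset.sum_mul, Finset.sum_sub_distrib, ← Finset.sum_div, hp1,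
    ← hZdef, div_self hZ.ne'] at this
  unfold klReal
  linarith

theorem klReal_nonneg {p q : α → ℝ} (hp : p ∈ stdSimplex ℝ α) (hq : q ∈ stdSimplex ℝ α)
    (hac : ∀ a, q a = 0 → p a = 0) : 0 ≤ klReal p q := by
  simpa [hq.2] using neg_log_sum_le_klReal hp hq.1 hac

theorem klReal_eq_sub {q : α → ℝ} (hq : ∀ a, 0 < q a) (p : α → ℝ) :
    klReal p q = ∑ a, (p a * Real.log (p a) - p a * Real.log (q a)) := by
  refine Finset.sum_congr rfl fun a _ => ?_
  by_cases h : p a = 0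
  · simp [h]
  · rw [Real.log_div h (hq a).ne', mul_sub]

theorem continuous_klReal {q : α → ℝ} (hq : ∀ a, 0 < q a) :
    Continuous fun p : α → ℝ => klReal p q := by
  simp only [klReal_eq_sub hq]
  refine continuous_finsetSum _ fun a _ => ?_
  exact (Real.continuous_mul_log.comp (continuous_apply a)).sub
    ((continuous_apply a).mul continuous_const)

theorem klReal_mix_le {q : α → ℝ} (hq : ∀ a, 0 < q a) {p₁ p₂ : α → ℝ} (h₁ : ∀ a, 0 ≤ p₁ a)
    (h₂ : ∀ a, 0 ≤ p₂ a) {s t : ℝ} (hs : 0 ≤ s) (ht : 0 ≤ t) (hst : s + t = 1) :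
    klReal (fun a => s * p₁ a + t * p₂ a) q ≤ s * klReal p₁ q + t * klReal p₂ q := by
  simp only [klReal_eq_sub hq, Finset.mul_sum, ← Finset.sum_add_distrib]
  refine Finset.sum_le_sum fun a _ => ?_
  have := Real.convexOn_mul_log.2 (h₁ a) (h₂ a) hs ht hst
  simp only [smul_eq_mul] at this
  nlinarith [this]

theorem exists_klReal_le {q : α → ℝ} (hq : ∀ a, 0 < q a) :
    ∃ L : ℝ, ∀ p ∈ stdSimplex ℝ α, klReal p q ≤ L := by
  obtain ⟨L, hL⟩ := (isCompact_stdSimplex ℝ α).bddAbove_image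
    (continuous_klReal hq).continuousOn
  exact ⟨L, fun p hp => hL ⟨p, hp, rfl⟩⟩

/-- A test function for `p` against `q` that almost attains the variational formula for relative
entropy. -/
theorem exists_test_klReal {p q : α → ℝ} (hp : p ∈ stdSimplex ℝ α) (hq : q ∈ stdSimplex ℝ α)
    (hac : ∀ a, q a = 0 → p a = 0) {η : ℝ} (hη : 0 < η) :
    ∃ h : α → ℝ, ∑ a, q a * Real.exp (h a) ≤ 1 ∧ klReal p q - η ≤ ∑ a, p a * h a := by
  -- Mixing a little of `q` into `p` keeps the logarithm of the density finite; it lowers the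
  -- value by at most `-log (1 - τ) = η`.
  set τ := 1 - Real.exp (-η) with hτ
  have hτ1 : 1 - τ = Real.exp (-η) := by rw [hτ]; ring
  have hτ0 : 0 < τ := by
    have : Real.exp (-η) < 1 := by rw [← Real.exp_zero, Real.exp_lt_exp]; linarith
    linarith
  refine ⟨fun a => Real.log (((1 - τ) * p a + τ * q a) / q a), ?_, ?_⟩
  · have : ∀ a, q a * Real.exp (Real.log (((1 - τ) * p a + τ * q a) / q a))
        = (1 - τ) * p a + τ * q a := by
      intro a
      rcases (hq.1 a).eq_or_lt with h | h
      · rw [hac a h.symm, ← h]; simp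
      · have := hp.1 a
        rw [Real.exp_log (by rw [hτ1]; positivity)]
        field_simp
    simp only [this, Finset.sum_add_distrib, ← Finset.mul_sum, hp.2, hq.2]
    linarith
  · have : ∀ a, p a * Real.log (p a / q a) - η * p a ≤
        p a * Real.log (((1 - τ) * p a + τ * q a) / q a) := by
      intro a
      rcases (hp.1 a).eq_or_lt with h | h
      · rw [← h]; simp
      · have hqa : 0 < q a := lt_of_le_of_ne (hq.1 a) fun h' => h.ne' (hac a h'.symm)
        have h1 : Real.log ((1 - τ) * (p a / q a)) ≤
            Real.log (((1 - τ) * p a + τ * q a) / q a) := by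
          apply Real.log_le_log
          · rw [hτ1]; positivity
          · rw [← mul_div_assoc]
            gcongr
            nlinarith
        rw [Real.log_mul (by rw [hτ1]; positivity) (by positivity), hτ1, Real.log_exp] at h1
        rw [hτ1]
        nlinarith
    have := Finset.sum_le_sum fun a (_ : a ∈ Finset.univ) => this a
    rw [Finset.sum_sub_distrib, ← Finset.mul_sum, hp.2] at this
    unfold klReal
    linarith

/-- To first order in `s`, the exponential moment `∑ p exp (s h)` is governed by the mean. -/
theorem eventually_sum_mul_exp_lt {p : α → ℝ} (hp : p ∈ stdSimplex ℝ α) (h : α → ℝ) {t : ℝ}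
    (ht : ∑ a, p a * h a < t) :
    ∀ᶠ s in nhdsWithin (0 : ℝ) (Set.Ioi 0), ∑ a, p a * Real.exp (s * h a) < Real.exp (s * t) := by
  set G : ℝ → ℝ := fun s => ∑ a, p a * Real.exp (s * h a) - Real.exp (s * t) with hG
  have hd : HasDerivAt G (∑ a, p a * h a - t) 0 := by
    have h1 : ∀ c : ℝ, HasDerivAt (fun s : ℝ => Real.exp (s * c)) c 0 := by
      intro c
      simpa using ((hasDerivAt_id (0 : ℝ)).mul_const c).exp
    exact (HasDerivAt.fun_sum fun a _ => (h1 (h a)).const_mul (p a)).sub (h1 t)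
  have hG0 : G 0 = 0 := by simp [hG, hp.2]
  have h1 := (hasDerivAt_iff_tendsto_slope.1 hd).eventually (gt_mem_nhds (sub_neg.2 ht))
  have h2 : ∀ᶠ s in nhdsWithin (0 : ℝ) (Set.Ioi 0), slope G 0 s < 0 :=
    h1.filter_mono (nhdsWithin_mono _ fun x (hx : (0 : ℝ) < x) => hx.ne')
  filter_upwards [h2, self_mem_nhdsWithin] with s hs hs0
  have hs0 : 0 < s := hs0
  rw [slope_def_field, hG0, sub_zero, sub_zero] at hs
  have : G s < 0 := by
    by_contra hcon
    exact absurd hs (not_lt.2 (div_nonneg (not_lt.1 hcon) hs0.le))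
  simpa [hG] using this

end Divergence

/-! ### The minimal divergence under marginal constraints -/

section Coupling

theorem margU_prod {U V : Type*} [Fintype V] {a : U → ℝ} {b : V → ℝ} (hb : ∑ v, b v = 1) :
    margU (fun w : U × V => a w.1 * b w.2) = a := by
  funext u; simp [margU, ← Finset.mul_sum, hb]

theorem margV_prod {U V : Type*} [Fintype U] {a : U → ℝ} {b : V → ℝ} (ha : ∑ u, a u = 1) :
    margV (fun w : U × V => a w.1 * b w.2) = b := by
  funext v; simp [margV, ← Finset.sum_mul, ha]

variable {U V : Type*} [Fintype U] [Fintype V]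

theorem margU_mem_stdSimplex {p : U × V → ℝ} (hp : p ∈ stdSimplex ℝ (U × V)) :
    margU p ∈ stdSimplex ℝ U :=
  ⟨fun u => Finset.sum_nonneg fun v _ => hp.1 (u, v), by
    rw [← hp.2, Fintype.sum_prod_type]; rfl⟩

theorem margV_mem_stdSimplex {p : U × V → ℝ} (hp : p ∈ stdSimplex ℝ (U × V)) :
    margV p ∈ stdSimplex ℝ V :=
  ⟨fun v => Finset.sum_nonneg fun u _ => hp.1 (u, v), by
    rw [← hp.2, Fintype.sum_prod_type_right]; rfl⟩

theorem prod_mem_stdSimplex {a : U → ℝ} {b : V → ℝ} (ha : a ∈ stdSimplex ℝ U)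
    (hb : b ∈ stdSimplex ℝ V) : (fun w : U × V => a w.1 * b w.2) ∈ stdSimplex ℝ (U × V) :=
  ⟨fun w => mul_nonneg (ha.1 _) (hb.1 _), by
    rw [Fintype.sum_prod_type]; simp [← Finset.mul_sum, ha.2, hb.2]⟩

theorem sum_mul_fst (p : U × V → ℝ) (φ : U → ℝ) :
    ∑ w, p w * φ w.1 = ∑ u, margU p u * φ u := by
  rw [Fintype.sum_prod_type]; simp [margU, Finset.sum_mul]

theorem sum_mul_snd (p : U × V → ℝ) (ψ : V → ℝ) :
    ∑ w, p w * ψ w.2 = ∑ v, margV p v * ψ v := by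
  rw [Fintype.sum_prod_type_right]; simp [margV, Finset.sum_mul]

variable {a : U → ℝ} {b : V → ℝ} {Q : U × V → ℝ}

theorem minDivergence_ne_top (ha : a ∈ stdSimplex ℝ U) (hb : b ∈ stdSimplex ℝ V)
    (hQ : ∀ w, 0 < Q w) : minDivergence a b Q ≠ ⊤ := by
  refine ne_top_of_le_ne_top ?_ (iInf₂_le (fun w : U × V => a w.1 * b w.2)
    ⟨prod_mem_stdSimplex ha hb, margU_prod hb.2, margV_prod ha.2⟩)
  rw [relEntropy_eq_ofReal fun w h => absurd h (hQ w).ne']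
  exact ENNReal.ofReal_ne_top

theorem toReal_minDivergence_le (hQ : Q ∈ stdSimplex ℝ (U × V)) (hQp : ∀ w, 0 < Q w)
    {π : U × V → ℝ} (hπ : π ∈ stdSimplex ℝ (U × V)) (hU : margU π = a) (hV : margV π = b) :
    (minDivergence a b Q).toReal ≤ klReal π Q := by
  have hac : ∀ w, Q w = 0 → π w = 0 := fun w h => absurd h (hQp w).ne'
  have h1 : minDivergence a b Q ≤ relEntropy π Q := iInf₂_le π ⟨hπ, hU, hV⟩
  rw [relEntropy_eq_ofReal hac] at h1
  exact ENNReal.toReal_le_of_le_ofReal (klReal_nonneg hπ hQ hac) h1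

theorem exists_klReal_lt_toReal_minDivergence (ha : a ∈ stdSimplex ℝ U) (hb : b ∈ stdSimplex ℝ V)
    (hQp : ∀ w, 0 < Q w) {η : ℝ} (hη : 0 < η) :
    ∃ π ∈ stdSimplex ℝ (U × V), margU π = a ∧ margV π = b ∧
      klReal π Q < (minDivergence a b Q).toReal + η := by
  have hlt : minDivergence a b Q < ENNReal.ofReal ((minDivergence a b Q).toReal + η) := by
    rw [ENNReal.lt_ofReal_iff_toReal_lt (minDivergence_ne_top ha hb hQp)]
    linarith
  simp only [minDivergence, iInf_lt_iff] at hlt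
  obtain ⟨π, ⟨hπ, hU, hV⟩, h⟩ := hlt
  refine ⟨π, hπ, hU, hV, ?_⟩
  rw [relEntropy_eq_ofReal fun w h => absurd h (hQp w).ne'] at h
  exact (ENNReal.ofReal_lt_ofReal_iff'.1 h).1

open scoped Pointwise in
/-- Lagrangian duality for the minimal divergence: the optimal value is approached by functions
`φ`, `ψ` of the two coordinates. They are obtained by separating the point `(a, b, E - η)` from the
closed convex set of triples `(π_U, π_V, s)` with `s ≥ D(π‖Q)`. -/
theorem exists_dual_potentials (ha : a ∈ stdSimplex ℝ U) (hb : b ∈ stdSimplex ℝ V)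
    (hQ : Q ∈ stdSimplex ℝ (U × V)) (hQp : ∀ w, 0 < Q w) {η : ℝ} (hη : 0 < η) :
    ∃ (φ : U → ℝ) (ψ : V → ℝ), ∑ w : U × V, Q w * Real.exp (φ w.1 + ψ w.2) ≤
      Real.exp (∑ u, a u * φ u + ∑ v, b v * ψ v - (minDivergence a b Q).toReal + η) := by
  classical
  set E := (minDivergence a b Q).toReal with hE
  set S : Set ((U → ℝ) × (V → ℝ) × ℝ) := {z | ∃ π ∈ stdSimplex ℝ (U × V),
    margU π = z.1 ∧ margV π = z.2.1 ∧ klReal π Q ≤ z.2.2} with hS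
  have hconv : Convex ℝ S := by
    rintro z ⟨π, hπ, h1, h2, h3⟩ z' ⟨π', hπ', h1', h2', h3'⟩ s t hs ht hst
    refine ⟨fun w => s * π w + t * π' w, convex_stdSimplex ℝ _ hπ hπ' hs ht hst, ?_, ?_, ?_⟩
    · funext u
      simp [← h1, ← h1', margU, Finset.sum_add_distrib, Finset.mul_sum]
    · funext v
      simp [← h2, ← h2', margV, Finset.sum_add_distrib, Finset.mul_sum]
    · refine (klReal_mix_le hQp hπ.1 hπ'.1 hs ht hst).trans ?_
      simp only [Prod.snd_add, Prod.smul_snd, smul_eq_mul]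
      gcongr
  have hclosed : IsClosed S := by
    set F : (U × V → ℝ) → (U → ℝ) × (V → ℝ) × ℝ := fun π => (margU π, margV π, klReal π Q)
    have hF : Continuous F := by
      refine Continuous.prodMk ?_ (Continuous.prodMk ?_ (continuous_klReal hQp))
      · unfold margU; fun_prop
      · unfold margV; fun_prop
    have hray : IsClosed (({0} : Set (U → ℝ)) ×ˢ ({0} : Set (V → ℝ)) ×ˢ Set.Ici (0 : ℝ)) :=
      isClosed_singleton.prod (isClosed_singleton.prod isClosed_Ici)
    have hSeq : S = F '' stdSimplex ℝ (U × V) +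
        (({0} : Set (U → ℝ)) ×ˢ ({0} : Set (V → ℝ)) ×ˢ Set.Ici (0 : ℝ)) := by
      ext ⟨z1, z2, z3⟩
      constructor
      · rintro ⟨π, hπ, h1, h2, h3⟩
        refine Set.mem_add.2 ⟨F π, ⟨π, hπ, rfl⟩, (0, 0, z3 - klReal π Q), ?_, ?_⟩
        · simpa using h3
        · simp [F, h1, h2]
      · intro h
        obtain ⟨x, ⟨π, hπ, rfl⟩, ⟨y1, y2, y3⟩, ⟨hy1, hy2, hy3⟩, hxy⟩ := Set.mem_add.1 h
        simp only [Set.mem_singleton_iff, Set.mem_Ici] at hy1 hy2 hy3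
        subst hy1 hy2
        simp only [F, Prod.mk_add_mk, Prod.mk.injEq, add_zero] at hxy
        exact ⟨π, hπ, hxy.1, hxy.2.1, by simp only; linarith [hxy.2.2]⟩
    rw [hSeq]
    exact hray.add_left_of_isCompact ((isCompact_stdSimplex ℝ _).image hF)
  have hnot : ((a, b, E - η) : (U → ℝ) × (V → ℝ) × ℝ) ∉ S := by
    rintro ⟨π, hπ, h1, h2, h3⟩
    have := toReal_minDivergence_le hQ hQp hπ h1 h2
    simp only at h3
    linarith
  obtain ⟨f, r, hf, hr⟩ := geometric_hahn_banach_closed_point hconv hclosed hnot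
  set φ₀ : U → ℝ := fun u => f (fun j => if u = j then 1 else 0, 0, 0)
  set ψ₀ : V → ℝ := fun v => f (0, fun j => if v = j then 1 else 0, 0)
  set l : ℝ := f (0, 0, 1) with hl
  have hfz : ∀ x y s, f (x, y, s) = ∑ u, x u * φ₀ u + ∑ v, y v * ψ₀ v + s * l := by
    intro x y s
    have h1 : f (x, 0, 0) = ∑ u, x u * φ₀ u := by
      have := (f.toLinearMap ∘ₗ LinearMap.inl ℝ (U → ℝ) ((V → ℝ) × ℝ)).pi_apply_eq_sum_univ x
      exact this
    have h2 : f (0, y, 0) = ∑ v, y v * ψ₀ v := by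
      have := (f.toLinearMap ∘ₗ LinearMap.inr ℝ (U → ℝ) ((V → ℝ) × ℝ) ∘ₗ
        LinearMap.inl ℝ (V → ℝ) ℝ).pi_apply_eq_sum_univ y
      exact this
    have h3 : f (0, 0, s) = s * l := by
      rw [hl, ← smul_eq_mul, ← map_smul]; simp
    rw [← h1, ← h2, ← h3, ← map_add, ← map_add]; simp
  -- The last coordinate of the separating functional is negative, as the epigraph extends upwards
  -- and contains points arbitrarily close to `(a, b, E)`.
  have hlneg : l < 0 := by
    obtain ⟨π, hπ, h1, h2, h3⟩ := exists_klReal_lt_toReal_minDivergence ha hb hQp hη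
    have h4 := hf (a, b, E + η) ⟨π, hπ, h1, h2, h3.le⟩
    have h5 := h4.trans hr
    rw [hfz, hfz] at h5
    nlinarith
  refine ⟨fun u => φ₀ u / -l, fun v => ψ₀ v / -l, ?_⟩
  set W : U × V → ℝ := fun w => Q w * Real.exp (φ₀ w.1 / -l + ψ₀ w.2 / -l) with hW
  have hWp : ∀ w, 0 < W w := fun w => mul_pos (hQp w) (Real.exp_pos _)
  have hne : Nonempty (U × V) := by
    by_contra h
    rw [not_nonempty_iff] at h
    simpa using hQ.2
  have hZ : 0 < ∑ w, W w := Finset.sum_pos (fun w _ => hWp w) Finset.univ_nonempty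
  set Z := ∑ w, W w with hZdef
  -- The tilted law `W / Z` maximizes the Lagrangian, with maximum `log Z`.
  have hπ : (fun w => W w / Z) ∈ stdSimplex ℝ (U × V) :=
    ⟨fun w => (div_pos (hWp w) hZ).le, by rw [← Finset.sum_div, div_self hZ.ne']⟩
  set π : U × V → ℝ := fun w => W w / Z with hπdef
  have hkl : klReal π Q = (∑ u, margU π u * φ₀ u + ∑ v, margV π v * ψ₀ v) / -l - Real.log Z := by
    have : ∀ w, π w * Real.log (π w / Q w) =
        (π w * φ₀ w.1 + π w * ψ₀ w.2) / -l - π w * Real.log Z := by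
      intro w
      have : π w / Q w = Real.exp (φ₀ w.1 / -l + ψ₀ w.2 / -l) / Z := by
        have := (hQp w).ne'
        simp only [hπdef, hW]
        field_simp
      rw [this, Real.log_div (Real.exp_pos _).ne' hZ.ne', Real.log_exp]
      ring
    unfold klReal
    rw [Finset.sum_congr rfl fun w _ => this w, Finset.sum_sub_distrib, ← Finset.sum_div,
      Finset.sum_add_distrib, ← Finset.sum_mul, hπ.2, sum_mul_fst, sum_mul_snd, one_mul]
  have h6 := (hf (margU π, margV π, klReal π Q) ⟨π, hπ, rfl, rfl, le_rfl⟩).trans hr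
  rw [hfz, hfz] at h6
  have h7 : Real.log Z ≤ ∑ u, a u * (φ₀ u / -l) + ∑ v, b v * (ψ₀ v / -l) - E + η := by
    have e1 : ∑ u, a u * (φ₀ u / -l) = (∑ u, a u * φ₀ u) / -l := by
      rw [Finset.sum_div]; simp only [mul_div_assoc]
    have e2 : ∑ v, b v * (ψ₀ v / -l) = (∑ v, b v * ψ₀ v) / -l := by
      rw [Finset.sum_div]; simp only [mul_div_assoc]
    rw [e1, e2]
    have hm : 0 < -l := by linarith
    have h8 : Real.log Z * -l = (∑ u, margU π u * φ₀ u + ∑ v, margV π v * ψ₀ v)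
        + klReal π Q * l := by
      rw [hkl]
      have := hlneg.ne
      field_simp
      ring
    rw [← mul_le_mul_iff_left₀ hm, h8]
    have h9 : ((∑ u, a u * φ₀ u) / -l + (∑ v, b v * ψ₀ v) / -l - E + η) * -l =
        ∑ u, a u * φ₀ u + ∑ v, b v * ψ₀ v + (E - η) * l := by
      have := hlneg.ne
      field_simp
      ring
    rw [h9]
    linarith
  rw [← Real.log_le_iff_le_exp hZ]
  exact h7

end Coupling

/-! ### A reverse hypercontractive inequality -/

section ReverseHypercontractivity

variable {U V : Type*} [Fintype U] [Fintype V]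

/-- A coupling of marginals `a'`, `b'` that nearly dominate the marginals of `π` costs little more
than `π`. -/
theorem exists_coupling_klReal_le {Q : U × V → ℝ} (hQp : ∀ w, 0 < Q w) {L : ℝ}
    (hL : ∀ p ∈ stdSimplex ℝ (U × V), klReal p Q ≤ L) {π : U × V → ℝ}
    (hπ : π ∈ stdSimplex ℝ (U × V)) {a' : U → ℝ} {b' : V → ℝ} (ha' : a' ∈ stdSimplex ℝ U)
    (hb' : b' ∈ stdSimplex ℝ V) {τ : ℝ} (hτ0 : 0 < τ) (hτ1 : τ ≤ 1)
    (hau : ∀ u, (1 - τ) * margU π u ≤ a' u) (hbv : ∀ v, (1 - τ) * margV π v ≤ b' v) :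
    ∃ π' ∈ stdSimplex ℝ (U × V), margU π' = a' ∧ margV π' = b' ∧
      klReal π' Q ≤ (1 - τ) * klReal π Q + τ * L := by
  set a₁ : U → ℝ := fun u => (a' u - (1 - τ) * margU π u) / τ with ha₁
  set b₁ : V → ℝ := fun v => (b' v - (1 - τ) * margV π v) / τ with hb₁
  have h1 : a₁ ∈ stdSimplex ℝ U := ⟨fun u => div_nonneg (sub_nonneg.2 (hau u)) hτ0.le, by
    rw [← Finset.sum_div, Finset.sum_sub_distrib, ← Finset.mul_sum, ha'.2,
      (margU_mem_stdSimplex hπ).2]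
    field_simp; ring⟩
  have h2 : b₁ ∈ stdSimplex ℝ V := ⟨fun u => div_nonneg (sub_nonneg.2 (hbv u)) hτ0.le, by
    rw [← Finset.sum_div, Finset.sum_sub_distrib, ← Finset.mul_sum, hb'.2,
      (margV_mem_stdSimplex hπ).2]
    field_simp; ring⟩
  have h3 := prod_mem_stdSimplex h1 h2
  have hs : 0 ≤ 1 - τ := by linarith
  refine ⟨fun w => (1 - τ) * π w + τ * (a₁ w.1 * b₁ w.2),
    convex_stdSimplex ℝ _ hπ h3 hs hτ0.le (by ring), ?_, ?_, ?_⟩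
  · funext u
    have : margU (fun w : U × V => a₁ w.1 * b₁ w.2) u = a₁ u := by rw [margU_prod h2.2]
    simp only [margU, Finset.sum_add_distrib, ← Finset.mul_sum] at this ⊢
    rw [this]; simp only [ha₁, margU]; field_simp; ring
  · funext v
    have : margV (fun w : U × V => a₁ w.1 * b₁ w.2) v = b₁ v := by rw [margV_prod h1.2]
    simp only [margV, Finset.sum_add_distrib, ← Finset.mul_sum] at this ⊢
    rw [this]; simp only [hb₁, margV]; field_simp; ring
  · refine (klReal_mix_le hQp hπ.1 h3.1 hs hτ0.le (by ring)).trans ?_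
    have := hL _ h3
    gcongr

/-- If `∑ a f = 1`, then `∑ a f log f` is the relative entropy of the law `a f` from `a`: it is
nonnegative, and bounded away from zero once `f` is bounded away from one at some atom of `a`. -/
theorem exists_le_sum_mul_log {α : Type*} [Fintype α] {a : α → ℝ} (ha : a ∈ stdSimplex ℝ α)
    {τ : ℝ} (hτ0 : 0 < τ) :
    ∃ d > 0, ∀ f : α → ℝ, (∀ x, 0 ≤ f x) → ∑ x, a x * f x = 1 →
      0 ≤ ∑ x, a x * f x * Real.log (f x) ∧
      ((∃ x, 0 < a x ∧ f x < 1 - τ) → d ≤ ∑ x, a x * f x * Real.log (f x)) := by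
  obtain ⟨d₁, hd₁, hd₁'⟩ : ∃ d > 0, ∀ t, 0 ≤ t → t < 1 - τ → d ≤ InformationTheory.klFun t := by
    by_cases hτ1 : 0 ≤ 1 - τ
    · obtain ⟨x, hx, hmin⟩ := isCompact_Icc.exists_isMinOn (Set.nonempty_Icc.2 hτ1)
        InformationTheory.continuous_klFun.continuousOn
      refine ⟨InformationTheory.klFun x, ?_, fun t h0 h1 => hmin ⟨h0, h1.le⟩⟩
      refine lt_of_le_of_ne (InformationTheory.klFun_nonneg hx.1) fun h => ?_
      have := (InformationTheory.klFun_eq_zero_iff hx.1).1 h.symm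
      linarith [hx.2]
    · exact ⟨1, one_pos, fun t h0 h1 => by linarith⟩
  obtain ⟨m, hm, hm'⟩ : ∃ m > 0, ∀ x, 0 < a x → m ≤ a x := by
    by_cases hne : (Finset.univ.filter fun x => 0 < a x).Nonempty
    · obtain ⟨x, hx, hx'⟩ := Finset.exists_min_image _ a hne
      exact ⟨a x, (Finset.mem_filter.1 hx).2, fun y hy => hx' y (by simp [hy])⟩
    · exact ⟨1, one_pos, fun x hx => absurd ⟨x, by simp [hx]⟩ hne⟩
  refine ⟨m * d₁, by positivity, fun f hf hsum => ?_⟩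
  have heq : ∑ x, a x * f x * Real.log (f x) = ∑ x, a x * InformationTheory.klFun (f x) := by
    have : ∀ x, a x * InformationTheory.klFun (f x) =
        a x * f x * Real.log (f x) + (a x - a x * f x) := by
      intro x; rw [InformationTheory.klFun_apply]; ring
    simp only [this, Finset.sum_add_distrib, Finset.sum_sub_distrib, hsum, ha.2]
    ring
  have hnn : ∀ x, 0 ≤ a x * InformationTheory.klFun (f x) := fun x =>
    mul_nonneg (ha.1 x) (InformationTheory.klFun_nonneg (hf x))
  rw [heq]
  refine ⟨Finset.sum_nonneg fun x _ => hnn x, ?_⟩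
  rintro ⟨x, hx, hfx⟩
  calc m * d₁ ≤ a x * InformationTheory.klFun (f x) :=
        mul_le_mul (hm' x hx) (hd₁' _ (hf x) hfx) hd₁.le hx.le
    _ ≤ _ := Finset.single_le_sum (f := fun x => a x * InformationTheory.klFun (f x))
        (fun x _ => hnn x) (Finset.mem_univ x)

/-- One-letter reverse hypercontractivity, with the constant `exp (-E)` where `E` is the minimal
divergence, up to an arbitrarily small loss in the exponent. By Gibbs' inequality it suffices to
couple the tilted laws `a f` and `b g` at divergence at most
`E + η + K (D(a f‖a) + D(b g‖b))`. -/
theorem exists_reverse_hypercontractive {a : U → ℝ} {b : V → ℝ} {Q : U × V → ℝ}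
    (ha : a ∈ stdSimplex ℝ U) (hb : b ∈ stdSimplex ℝ V) (hQp : ∀ w, 0 < Q w) {η : ℝ}
    (hη : 0 < η) : ∃ K : ℕ, K ≠ 0 ∧ ∀ (f : U → ℝ) (g : V → ℝ), (∀ u, 0 ≤ f u) → (∀ v, 0 ≤ g v) →
      Real.exp (-((minDivergence a b Q).toReal + η)) * ((∑ u, a u * f u) ^ K *
        (∑ v, b v * g v) ^ K) ≤ ∑ w : U × V, Q w * (f w.1 ^ K * g w.2 ^ K) := by
  classical
  set E := (minDivergence a b Q).toReal with hE
  have hE0 : 0 ≤ E := ENNReal.toReal_nonneg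
  obtain ⟨L₀, hL₀⟩ := exists_klReal_le hQp
  set L := max L₀ 0
  have hL0 : 0 ≤ L := le_max_right _ _
  have hL : ∀ p ∈ stdSimplex ℝ (U × V), klReal p Q ≤ L := fun p hp =>
    (hL₀ p hp).trans (le_max_left _ _)
  obtain ⟨π, hπ, hπU, hπV, hπE⟩ :=
    exists_klReal_lt_toReal_minDivergence ha hb hQp (half_pos hη)
  set τ : ℝ := min 1 (η / 2 / (L + 1)) with hτdef
  have hτ0 : 0 < τ := by positivity
  have hτ1 : τ ≤ 1 := min_le_left _ _
  have hτL : τ * L ≤ η / 2 := by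
    have : τ * (L + 1) ≤ η / 2 := by
      rw [← le_div_iff₀ (by positivity)]; exact min_le_right _ _
    nlinarith
  obtain ⟨d₁, hd₁, H₁⟩ := exists_le_sum_mul_log ha hτ0
  obtain ⟨d₂, hd₂, H₂⟩ := exists_le_sum_mul_log hb hτ0
  obtain ⟨K, hK⟩ := exists_nat_gt (max (L / d₁) (L / d₂))
  have hK1 : L ≤ K * d₁ := by
    rw [← div_le_iff₀ hd₁]; exact (le_max_left _ _).trans hK.le
  have hK2 : L ≤ K * d₂ := by
    rw [← div_le_iff₀ hd₂]; exact (le_max_right _ _).trans hK.le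
  have hK0 : K ≠ 0 := by
    rintro rfl
    have : 0 ≤ L / d₁ := by positivity
    have := (le_max_left (L / d₁) (L / d₂)).trans_lt hK
    simp at this; linarith
  refine ⟨K, hK0, ?_⟩
  -- The normalized inequality.
  have main : ∀ (f : U → ℝ) (g : V → ℝ), (∀ u, 0 ≤ f u) → (∀ v, 0 ≤ g v) →
      ∑ u, a u * f u = 1 → ∑ v, b v * g v = 1 →
      Real.exp (-(E + η)) ≤ ∑ w : U × V, Q w * (f w.1 ^ K * g w.2 ^ K) := by
    intro f g hf hg hfs hgs
    set a' : U → ℝ := fun u => a u * f u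
    set b' : V → ℝ := fun v => b v * g v
    have ha' : a' ∈ stdSimplex ℝ U := ⟨fun u => mul_nonneg (ha.1 u) (hf u), hfs⟩
    have hb' : b' ∈ stdSimplex ℝ V := ⟨fun u => mul_nonneg (hb.1 u) (hg u), hgs⟩
    obtain ⟨h1, h1'⟩ := H₁ f hf hfs
    obtain ⟨h2, h2'⟩ := H₂ g hg hgs
    set A := ∑ u, a u * f u * Real.log (f u)
    set B := ∑ v, b v * g v * Real.log (g v)
    obtain ⟨π', hπ', hU', hV', hkl⟩ : ∃ π' ∈ stdSimplex ℝ (U × V), margU π' = a' ∧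
        margV π' = b' ∧ klReal π' Q ≤ E + η + K * A + K * B := by
      have hKA : 0 ≤ K * A := by positivity
      have hKB : 0 ≤ K * B := by positivity
      by_cases hfar : (∃ u, 0 < a u ∧ f u < 1 - τ) ∨ (∃ v, 0 < b v ∧ g v < 1 - τ)
      · have hp := prod_mem_stdSimplex ha' hb'
        refine ⟨_, hp, margU_prod hgs, margV_prod hfs, (hL _ hp).trans ?_⟩
        rcases hfar with h | h
        · have := mul_le_mul_of_nonneg_left (h1' h) (Nat.cast_nonneg (α := ℝ) K)
          linarith
        · have := mul_le_mul_of_nonneg_left (h2' h) (Nat.cast_nonneg (α := ℝ) K)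
          linarith
      · push Not at hfar
        obtain ⟨π', hπ', hU', hV', h⟩ := exists_coupling_klReal_le hQp hL hπ ha' hb' hτ0 hτ1
          (fun u => by
            rw [hπU, mul_comm]
            rcases (ha.1 u).eq_or_lt with h | h
            · simp [a', ← h]
            · exact mul_le_mul_of_nonneg_left (hfar.1 u h) h.le)
          (fun v => by
            rw [hπV, mul_comm]
            rcases (hb.1 v).eq_or_lt with h | h
            · simp [b', ← h]
            · exact mul_le_mul_of_nonneg_left (hfar.2 v h) h.le)
        refine ⟨π', hπ', hU', hV', h.trans ?_⟩
        have : (1 - τ) * klReal π Q ≤ E + η / 2 := by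
          calc (1 - τ) * klReal π Q ≤ (1 - τ) * (E + η / 2) :=
                mul_le_mul_of_nonneg_left hπE.le (by linarith)
            _ ≤ 1 * (E + η / 2) := by gcongr; linarith
            _ = _ := one_mul _
        linarith
    have hsupp : ∀ w : U × V, π' w ≠ 0 → f w.1 ≠ 0 ∧ g w.2 ≠ 0 := by
      intro w hw
      have hwp : 0 < π' w := lt_of_le_of_ne (hπ'.1 w) hw.symm
      have e1 : 0 < a' w.1 := by
        rw [← hU']
        exact hwp.trans_le (Finset.single_le_sum (f := fun v => π' (w.1, v))
          (fun v _ => hπ'.1 _) (Finset.mem_univ w.2))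
      have e2 : 0 < b' w.2 := by
        rw [← hV']
        exact hwp.trans_le (Finset.single_le_sum (f := fun u => π' (u, w.2))
          (fun v _ => hπ'.1 _) (Finset.mem_univ w.1))
      exact ⟨right_ne_zero_of_mul e1.ne', right_ne_zero_of_mul e2.ne'⟩
    set W : U × V → ℝ := fun w => Q w * (f w.1 ^ K * g w.2 ^ K) with hWdef
    have hW : ∀ w, 0 ≤ W w := fun w =>
      mul_nonneg (hQp w).le (mul_nonneg (pow_nonneg (hf _) _) (pow_nonneg (hg _) _))
    have hWac : ∀ w, W w = 0 → π' w = 0 := by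
      intro w h
      by_contra hne
      obtain ⟨e1, e2⟩ := hsupp w hne
      exact absurd h (mul_ne_zero (hQp w).ne' (mul_ne_zero (pow_ne_zero _ e1) (pow_ne_zero _ e2)))
    have hG := neg_log_sum_le_klReal hπ' hW hWac
    have hsplit : klReal π' W = klReal π' Q - K * A - K * B := by
      have hA : A = ∑ w, π' w * Real.log (f w.1) := by
        rw [sum_mul_fst π' fun u => Real.log (f u), hU']
      have hB : B = ∑ w, π' w * Real.log (g w.2) := by
        rw [sum_mul_snd π' fun v => Real.log (g v), hV']
      rw [hA, hB, Finset.mul_sum, Finset.mul_sum, klReal, klReal, ← Finset.sum_sub_distrib,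
        ← Finset.sum_sub_distrib]
      refine Finset.sum_congr rfl fun w _ => ?_
      by_cases hw : π' w = 0
      · simp [hw]
      · obtain ⟨e1, e2⟩ := hsupp w hw
        have e3 := (hQp w).ne'
        rw [Real.log_div hw (by positivity), Real.log_div hw e3, hWdef]
        simp only
        rw [Real.log_mul e3 (by positivity), Real.log_mul (by positivity) (by positivity),
          Real.log_pow, Real.log_pow]
        ring
    have hZ : 0 < ∑ w, W w := by
      refine lt_of_le_of_ne (Finset.sum_nonneg fun w _ => hW w) fun h => ?_
      have h0 := (Finset.sum_eq_zero_iff_of_nonneg fun w _ => hW w).1 h.symm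
      have : ∑ w, π' w = 0 := Finset.sum_eq_zero fun w hw => hWac w (h0 w hw)
      rw [hπ'.2] at this
      exact one_ne_zero this
    rw [← Real.le_log_iff_exp_le hZ]
    linarith
  intro f g hf hg
  set F := ∑ u, a u * f u
  set G := ∑ v, b v * g v
  have hR : 0 ≤ ∑ w : U × V, Q w * (f w.1 ^ K * g w.2 ^ K) := Finset.sum_nonneg fun w _ =>
    mul_nonneg (hQp w).le (mul_nonneg (pow_nonneg (hf _) _) (pow_nonneg (hg _) _))
  have hF0 : 0 ≤ F := Finset.sum_nonneg fun u _ => mul_nonneg (ha.1 u) (hf u)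
  have hG0 : 0 ≤ G := Finset.sum_nonneg fun u _ => mul_nonneg (hb.1 u) (hg u)
  rcases hF0.eq_or_lt with h | hF
  · rw [← h, zero_pow hK0]; simpa using hR
  rcases hG0.eq_or_lt with h | hG
  · rw [← h, zero_pow hK0]; simpa using hR
  have hsumF : ∑ u, a u * (f u / F) = 1 := by
    simp only [← mul_div_assoc]; rw [← Finset.sum_div, div_self hF.ne']
  have hsumG : ∑ v, b v * (g v / G) = 1 := by
    simp only [← mul_div_assoc]; rw [← Finset.sum_div, div_self hG.ne']
  have := main (fun u => f u / F) (fun v => g v / G) (fun u => div_nonneg (hf u) hF0)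
    (fun v => div_nonneg (hg v) hG0) hsumF hsumG
  have hrw : ∑ w : U × V, Q w * ((f w.1 / F) ^ K * (g w.2 / G) ^ K) =
      (∑ w : U × V, Q w * (f w.1 ^ K * g w.2 ^ K)) / (F ^ K * G ^ K) := by
    rw [Finset.sum_div]
    refine Finset.sum_congr rfl fun w _ => ?_
    rw [div_pow, div_pow]; field_simp
  rw [hrw, le_div_iff₀ (by positivity)] at this
  exact this

theorem sum_fin_succ_fun {α : Type*} [Fintype α] {n : ℕ} (F : (Fin (n + 1) → α) → ℝ) :
    ∑ w, F w = ∑ x, ∑ w : Fin n → α, F (Fin.cons x w) := by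
  rw [← Fintype.sum_prod_type', ← (Fin.consEquiv fun _ : Fin (n + 1) => α).sum_comp]
  rfl

/-- A reverse hypercontractive inequality tensorizes: apply it to the last `n` letters for fixed
first letters, and then to the first letter. -/
theorem reverse_hypercontractive_iid {a : U → ℝ} {b : V → ℝ} {Q : U × V → ℝ} {κ : ℝ} {K : ℕ}
    (ha : ∀ u, 0 ≤ a u) (hb : ∀ v, 0 ≤ b v) (hQ : ∀ w, 0 ≤ Q w)
    (h : ∀ (f : U → ℝ) (g : V → ℝ), (∀ u, 0 ≤ f u) → (∀ v, 0 ≤ g v) →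
      Real.exp (-κ) * ((∑ u, a u * f u) ^ K * (∑ v, b v * g v) ^ K) ≤
        ∑ w : U × V, Q w * (f w.1 ^ K * g w.2 ^ K)) (n : ℕ) :
    ∀ (f : (Fin n → U) → ℝ) (g : (Fin n → V) → ℝ), (∀ u, 0 ≤ f u) → (∀ v, 0 ≤ g v) →
      Real.exp (-(n * κ)) * ((∑ u, (∏ i, a (u i)) * f u) ^ K * (∑ v, (∏ i, b (v i)) * g v) ^ K) ≤
        ∑ u : Fin n → U, ∑ v : Fin n → V, (∏ i, Q (u i, v i)) * (f u ^ K * g v ^ K) := by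
  induction n with
  | zero =>
    intro f g hf hg
    simp
  | succ n ih =>
    intro f g hf hg
    set F : U → ℝ := fun x => ∑ u : Fin n → U, (∏ i, a (u i)) * f (Fin.cons x u)
    set G : V → ℝ := fun y => ∑ v : Fin n → V, (∏ i, b (v i)) * g (Fin.cons y v)
    have hF : ∀ x, 0 ≤ F x := fun x => Finset.sum_nonneg fun u _ =>
      mul_nonneg (Finset.prod_nonneg fun i _ => ha _) (hf _)
    have hG : ∀ x, 0 ≤ G x := fun x => Finset.sum_nonneg fun u _ =>
      mul_nonneg (Finset.prod_nonneg fun i _ => hb _) (hg _)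
    have e1 : ∑ u : Fin (n + 1) → U, (∏ i, a (u i)) * f u = ∑ x, a x * F x := by
      rw [sum_fin_succ_fun]
      simp [F, Finset.mul_sum, Fin.prod_univ_succ, mul_assoc]
    have e2 : ∑ v : Fin (n + 1) → V, (∏ i, b (v i)) * g v = ∑ y, b y * G y := by
      rw [sum_fin_succ_fun]
      simp [G, Finset.mul_sum, Fin.prod_univ_succ, mul_assoc]
    have e3 : ∑ u : Fin (n + 1) → U, ∑ v : Fin (n + 1) → V,
        (∏ i, Q (u i, v i)) * (f u ^ K * g v ^ K) = ∑ w : U × V, Q w *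
          ∑ u : Fin n → U, ∑ v : Fin n → V, (∏ i, Q (u i, v i)) *
            (f (Fin.cons w.1 u) ^ K * g (Fin.cons w.2 v) ^ K) := by
      rw [sum_fin_succ_fun, Fintype.sum_prod_type]
      refine Finset.sum_congr rfl fun x _ => ?_
      simp only [sum_fin_succ_fun (α := V)]
      rw [Finset.sum_comm]
      simp [Finset.mul_sum, Fin.prod_univ_succ, mul_assoc]
    rw [e1, e2, e3]
    calc Real.exp (-((n + 1 : ℕ) * κ)) * ((∑ x, a x * F x) ^ K * (∑ y, b y * G y) ^ K)
        = Real.exp (-(n * κ)) * (Real.exp (-κ) *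
          ((∑ x, a x * F x) ^ K * (∑ y, b y * G y) ^ K)) := by
          rw [← mul_assoc (Real.exp _) (Real.exp _), ← Real.exp_add]; congr 2; push_cast; ring
      _ ≤ Real.exp (-(n * κ)) * ∑ w : U × V, Q w * (F w.1 ^ K * G w.2 ^ K) := by
          gcongr; exact h F G hF hG
      _ = ∑ w : U × V, Q w * (Real.exp (-(n * κ)) * (F w.1 ^ K * G w.2 ^ K)) := by
          rw [Finset.mul_sum]; refine Finset.sum_congr rfl fun w _ => ?_; ring
      _ ≤ _ := by
          refine Finset.sum_le_sum fun w _ => mul_le_mul_of_nonneg_left ?_ (hQ w)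
          exact ih _ _ (fun _ => hf _) (fun _ => hg _)

end ReverseHypercontractivity

/-! ### Sums over words -/

section Words

theorem sum_word_prod {α : Type*} [Fintype α] {n : ℕ} (F : Fin n → α → ℝ) :
    ∑ w : Fin n → α, ∏ i, F i (w i) = ∏ i, ∑ x, F i x := by
  classical
  rw [Finset.prod_univ_sum, Fintype.piFinset_univ]

variable {U V : Type*} [Fintype U] [Fintype V]

theorem sum_pair_word_prod {n : ℕ} (h : U × V → ℝ) :
    ∑ u : Fin n → U, ∑ v : Fin n → V, ∏ i, h (u i, v i) = (∑ w, h w) ^ n := by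
  have : ∀ u : Fin n → U, ∑ v : Fin n → V, ∏ i, h (u i, v i) = ∏ i, ∑ v, h (u i, v) :=
    fun u => sum_word_prod fun i v => h (u i, v)
  simp only [this]
  rw [sum_word_prod fun _ u => ∑ v, h (u, v), Fintype.sum_prod_type]
  simp

theorem sum_snd_word_prod {U V : Type*} [Fintype V] {n : ℕ} (R : U × V → ℝ) (u : Fin n → U) :
    ∑ v : Fin n → V, ∏ i, R (u i, v i) = ∏ i, margU R (u i) :=
  sum_word_prod fun i v => R (u i, v)

theorem sum_fst_word_prod {U V : Type*} [Fintype U] {n : ℕ} (R : U × V → ℝ) (v : Fin n → V) :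
    ∑ u : Fin n → U, ∏ i, R (u i, v i) = ∏ i, margV R (v i) :=
  sum_word_prod fun i u => R (u, v i)

theorem sum_word_iid {α : Type*} [Fintype α] {p : α → ℝ} (hp : p ∈ stdSimplex ℝ α) (n : ℕ) :
    ∑ w : Fin n → α, ∏ i, p (w i) = 1 := by
  rw [sum_word_prod fun _ x => p x, hp.2]; simp

theorem prod_word_nonneg {α : Type*} [Fintype α] {p : α → ℝ} (hp : p ∈ stdSimplex ℝ α) {n : ℕ}
    (w : Fin n → α) : 0 ≤ ∏ i, p (w i) :=
  Finset.prod_nonneg fun _ _ => hp.1 _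

end Words

/-! ### Acceptance probabilities -/

section Accept

variable {U V X Y : Type*} [Fintype Y]

/-- Conditional probability of deciding `0` given that the codeword is `x` and the receiver
observes `v`. -/
def acceptProb (Γ : X → Y → ℝ) {n : ℕ} (g : (Fin n → V) → (Fin n → Y) → Fin 2)
    (x : Fin n → X) (v : Fin n → V) : ℝ :=
  ∑ y : Fin n → Y, if g v y = 0 then ∏ i, Γ (x i) (y i) else 0

variable {Γ : X → Y → ℝ} {n : ℕ} {g : (Fin n → V) → (Fin n → Y) → Fin 2}

theorem prod_channel_nonneg (hΓ : ∀ x, Γ x ∈ stdSimplex ℝ Y) (x : Fin n → X) (y : Fin n → Y) :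
    0 ≤ ∏ i, Γ (x i) (y i) :=
  Finset.prod_nonneg fun _ _ => (hΓ _).1 _

theorem sum_prod_channel (hΓ : ∀ x, Γ x ∈ stdSimplex ℝ Y) (x : Fin n → X) :
    ∑ y : Fin n → Y, ∏ i, Γ (x i) (y i) = 1 := by
  rw [sum_word_prod fun i y => Γ (x i) y]
  exact Finset.prod_eq_one fun i _ => (hΓ _).2

theorem acceptProb_nonneg (hΓ : ∀ x, Γ x ∈ stdSimplex ℝ Y) (x : Fin n → X) (v : Fin n → V) :
    0 ≤ acceptProb Γ g x v :=
  Finset.sum_nonneg fun y _ => by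
    split_ifs
    · exact prod_channel_nonneg hΓ x y
    · exact le_rfl

theorem acceptProb_le_one (hΓ : ∀ x, Γ x ∈ stdSimplex ℝ Y) (x : Fin n → X) (v : Fin n → V) :
    acceptProb Γ g x v ≤ 1 := by
  rw [← sum_prod_channel hΓ x]
  refine Finset.sum_le_sum fun y _ => ?_
  split_ifs
  · exact le_rfl
  · exact prod_channel_nonneg hΓ x y

variable [Fintype U] [Fintype V]

theorem decisionProb_zero (R : U × V → ℝ) (Γ : X → Y → ℝ) (f : (Fin n → U) → (Fin n → X))
    (g : (Fin n → V) → (Fin n → Y) → Fin 2) : decisionProb R Γ f g 0 =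
      ∑ u : Fin n → U, ∑ v : Fin n → V, (∏ i, R (u i, v i)) * acceptProb Γ g (f u) v := by
  simp only [decisionProb, acceptProb, Finset.mul_sum, mul_ite, mul_zero]

theorem decisionProb_add (hΓ : ∀ x, Γ x ∈ stdSimplex ℝ Y) {R : U × V → ℝ}
    (hR : R ∈ stdSimplex ℝ (U × V)) (f : (Fin n → U) → (Fin n → X))
    (g : (Fin n → V) → (Fin n → Y) → Fin 2) :
    decisionProb R Γ f g 0 + decisionProb R Γ f g 1 = 1 := by
  have h1 : ∀ (u : Fin n → U) (v : Fin n → V) (y : Fin n → Y),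
      (if g v y = 0 then (∏ i, R (u i, v i)) * ∏ i, Γ (f u i) (y i) else 0) +
      (if g v y = 1 then (∏ i, R (u i, v i)) * ∏ i, Γ (f u i) (y i) else 0) =
      (∏ i, R (u i, v i)) * ∏ i, Γ (f u i) (y i) := by
    intro u v y
    rcases Fin.exists_fin_two.1 ⟨g v y, rfl⟩ with h | h <;> simp [h]
  simp only [decisionProb, ← Finset.sum_add_distrib, h1, ← Finset.mul_sum, sum_prod_channel hΓ,
    mul_one]
  rw [sum_pair_word_prod, hR.2, one_pow]

theorem decisionProb_nonneg (hΓ : ∀ x, Γ x ∈ stdSimplex ℝ Y) {R : U × V → ℝ}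
    (hR : R ∈ stdSimplex ℝ (U × V)) (f : (Fin n → U) → (Fin n → X))
    (g : (Fin n → V) → (Fin n → Y) → Fin 2) (h : Fin 2) : 0 ≤ decisionProb R Γ f g h := by
  refine Finset.sum_nonneg fun u _ => Finset.sum_nonneg fun v _ => Finset.sum_nonneg fun y _ => ?_
  split_ifs
  · exact mul_nonneg (Finset.prod_nonneg fun _ _ => hR.1 _) (prod_channel_nonneg hΓ _ _)
  · exact le_rfl

theorem expectedCost_eq (R : U × V → ℝ) (c : X → ℝ) (f : (Fin n → U) → (Fin n → X)) :
    expectedCost R c f = ∑ u : Fin n → U, (∏ j, margU R (u j)) * ∑ i, c (f u i) := by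
  simp only [expectedCost]
  rw [Finset.sum_comm]
  refine Finset.sum_congr rfl fun u _ => ?_
  rw [Finset.mul_sum]
  refine Finset.sum_congr rfl fun i _ => ?_
  rw [← Finset.sum_mul, sum_snd_word_prod]

end Accept

/-! ### Codewords of low cost -/

section LowCost

open scoped Classical in
/-- Markov's inequality for the cost of the codeword. -/
theorem sum_high_cost_le {U V X : Type*} [Fintype U] [Fintype V] {c : X → ℝ}
    (hc : ∀ x, 0 ≤ c x) {R : U × V → ℝ} (hR : R ∈ stdSimplex ℝ (U × V)) {n : ℕ}
    (f : (Fin n → U) → (Fin n → X)) {B ρ : ℝ} (hB : 0 < B)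
    (hcost : expectedCost R c f ≤ ρ * B) :
    ∑ u : Fin n → U, (if ∑ i, c (f u i) ≤ B then 0 else ∏ i, margU R (u i)) ≤ ρ := by
  rw [← mul_le_mul_iff_left₀ hB]
  refine le_trans ?_ hcost
  rw [expectedCost_eq, Finset.sum_mul]
  refine Finset.sum_le_sum fun u _ => ?_
  have h0 := prod_word_nonneg (margU_mem_stdSimplex hR) u
  split_ifs with h
  · rw [zero_mul]
    exact mul_nonneg h0 (Finset.sum_nonneg fun i _ => hc _)
  · exact mul_le_mul_of_nonneg_left (not_le.1 h).le h0

variable {U X : Type*} [Fintype U] [Fintype X] [Zero X]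

open scoped Classical in
/-- There are only subexponentially many words of cost `o(n)`. -/
theorem exists_card_low_cost_le {c : X → ℝ} (hc : ∀ x, 0 ≤ c x) (hc0 : ∀ x, c x = 0 ↔ x = 0)
    {δ : ℝ} (hδ : 0 < δ) : ∃ s : ℝ, 0 ≤ s ∧ ∀ (n : ℕ) (B : ℝ),
      ((Finset.univ.filter fun x : Fin n → X => ∑ i, c (x i) ≤ B).card : ℝ) ≤
        Real.exp (s * B + n * δ) := by
  have hlim : Tendsto (fun s : ℝ => ∑ x : X, Real.exp (-(s * c x))) atTop (nhds 1) := by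
    have : (1 : ℝ) = ∑ x : X, if x = 0 then 1 else 0 := by simp
    rw [this]
    refine tendsto_finsetSum _ fun x _ => ?_
    by_cases hx : x = 0
    · simp [hx, (hc0 0).2 rfl]
    · rw [if_neg hx]
      have hcx : 0 < c x := lt_of_le_of_ne (hc x) fun h => hx ((hc0 x).1 h.symm)
      exact Real.tendsto_exp_neg_atTop_nhds_zero.comp (tendsto_id.atTop_mul_const hcx)
  obtain ⟨s, hs, hs0⟩ := ((hlim.eventually (gt_mem_nhds (Real.one_lt_exp_iff.2 hδ))).and
    (eventually_ge_atTop 0)).exists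
  refine ⟨s, hs0, fun n B => ?_⟩
  calc ((Finset.univ.filter fun x : Fin n → X => ∑ i, c (x i) ≤ B).card : ℝ)
      = ∑ x : Fin n → X, if ∑ i, c (x i) ≤ B then (1 : ℝ) else 0 := by simp
    _ ≤ ∑ x : Fin n → X, Real.exp (s * B) * ∏ i, Real.exp (-(s * c (x i))) := by
        refine Finset.sum_le_sum fun x _ => ?_
        rw [← Real.exp_sum, ← Real.exp_add, Finset.sum_neg_distrib, ← Finset.mul_sum]
        split_ifs with h
        · rw [Real.one_le_exp_iff]
          nlinarith
        · exact (Real.exp_pos _).le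
    _ = Real.exp (s * B) * (∑ x : X, Real.exp (-(s * c x))) ^ n := by
        rw [← Finset.mul_sum, sum_word_prod fun _ x => Real.exp (-(s * c x))]; simp
    _ ≤ Real.exp (s * B) * Real.exp δ ^ n := by
        gcongr
    _ = _ := by rw [← Real.exp_nat_mul, ← Real.exp_add]

open scoped Classical in
/-- If the codewords of cost at most `B` carry weight `ρ`, one of them carries at least
`ρ exp (-(s B + n δ))`. -/
theorem exists_heavy_codeword {c : X → ℝ} (hc : ∀ x, 0 ≤ c x) (hc0 : ∀ x, c x = 0 ↔ x = 0)
    {δ : ℝ} (hδ : 0 < δ) : ∃ s : ℝ, 0 ≤ s ∧ ∀ (n : ℕ) (B ρ : ℝ) (W : (Fin n → U) → ℝ)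
      (f : (Fin n → U) → (Fin n → X)), 0 ≤ B → 0 ≤ ρ →
      ρ ≤ ∑ u, (if ∑ i, c (f u i) ≤ B then W u else 0) →
      ∃ x : Fin n → X, ∑ i, c (x i) ≤ B ∧
        ρ * Real.exp (-(s * B + n * δ)) ≤ ∑ u, if f u = x then W u else 0 := by
  obtain ⟨s, hs0, hs⟩ := exists_card_low_cost_le hc hc0 hδ
  refine ⟨s, hs0, fun n B ρ W f hB hρ hle => ?_⟩
  have hne : (Finset.univ.filter fun x : Fin n → X => ∑ i, c (x i) ≤ B).Nonempty :=
    ⟨fun _ => 0, by simp [(hc0 0).2 rfl, hB]⟩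
  obtain ⟨x, hx, hxW⟩ := Finset.exists_le_sum_fiber_of_maps_to_of_nsmul_le_sum
    (s := Finset.univ.filter fun u : Fin n → U => ∑ i, c (f u i) ≤ B)
    (t := Finset.univ.filter fun x : Fin n → X => ∑ i, c (x i) ≤ B) (f := f) (w := W)
    (b := ρ * Real.exp (-(s * B + n * δ))) (fun u hu => by simpa using hu) hne (by
      rw [Finset.sum_filter, nsmul_eq_mul]
      refine le_trans ?_ hle
      calc _ ≤ Real.exp (s * B + n * δ) * (ρ * Real.exp (-(s * B + n * δ))) := by
            gcongr; exact hs n B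
        _ = ρ := by rw [mul_left_comm, ← Real.exp_add]; simp)
  have hxB : ∑ i, c (x i) ≤ B := by simpa using hx
  refine ⟨x, hxB, hxW.trans (le_of_eq ?_)⟩
  rw [Finset.filter_filter, Finset.sum_filter]
  refine Finset.sum_congr rfl fun u _ => ?_
  by_cases h : f u = x
  · simp [h, hxB]
  · simp [h]

end LowCost

/-! ### Lower bounds on the miss-detection probability -/

section Converse

variable {U V X Y : Type*} [Fintype U] [Fintype V] [Fintype Y]

open scoped Classical in
/-- If one codeword `x` has many source words mapped to it and is often accepted, reverse
hypercontractivity bounds the miss-detection probability from below. -/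
theorem le_decisionProb_of_codeword {a : U → ℝ} {b : V → ℝ} {Q : U × V → ℝ} {Γ : X → Y → ℝ}
    (hΓ : ∀ x, Γ x ∈ stdSimplex ℝ Y) {κ : ℝ} {K : ℕ} (hK : K ≠ 0)
    (ha : ∀ u, 0 ≤ a u) (hb : ∀ v, 0 ≤ b v) (hQ : ∀ w, 0 ≤ Q w)
    (h : ∀ (f : U → ℝ) (g : V → ℝ), (∀ u, 0 ≤ f u) → (∀ v, 0 ≤ g v) →
      Real.exp (-κ) * ((∑ u, a u * f u) ^ K * (∑ v, b v * g v) ^ K) ≤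
        ∑ w : U × V, Q w * (f w.1 ^ K * g w.2 ^ K)) {n : ℕ}
    (f : (Fin n → U) → (Fin n → X)) (g : (Fin n → V) → (Fin n → Y) → Fin 2) (x : Fin n → X)
    {l : ℝ} (hl : 0 ≤ l)
    (h1 : l ≤ ∑ u : Fin n → U, if f u = x then ∏ i, a (u i) else 0)
    (h2 : l ≤ ∑ v : Fin n → V, (∏ i, b (v i)) * acceptProb Γ g x v) :
    Real.exp (-(n * κ)) * (l ^ K * l ^ K) ≤ decisionProb Q Γ f g 0 := by
  have key := reverse_hypercontractive_iid ha hb hQ h n (fun u => if f u = x then 1 else 0)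
    (acceptProb Γ g x) (fun u => by split_ifs <;> norm_num) (acceptProb_nonneg hΓ x)
  refine le_trans ?_ (key.trans ?_)
  · simp only [mul_ite, mul_one, mul_zero]
    have := pow_nonneg (hl.trans h1) K
    gcongr
  · rw [decisionProb_zero]
    refine Finset.sum_le_sum fun u _ => Finset.sum_le_sum fun v _ => ?_
    refine mul_le_mul_of_nonneg_left ?_ (Finset.prod_nonneg fun i _ => hQ _)
    have h0 := acceptProb_nonneg (g := g) hΓ (f u) v
    by_cases hux : f u = x
    · subst hux
      simp only [if_true, one_pow, one_mul]
      exact pow_le_of_le_one h0 (acceptProb_le_one hΓ _ v) hK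
    · simp only [if_neg hux, zero_pow hK, zero_mul]
      exact h0

variable [Fintype X]

open scoped Classical in
/-- A code with small cost and a fair chance of accepting under `P` has a cheap codeword that is
frequently sent and frequently accepted. -/
theorem exists_accepted_codeword [Zero X] {c : X → ℝ} (hc : ∀ x, 0 ≤ c x)
    (hc0 : ∀ x, c x = 0 ↔ x = 0) {P : U × V → ℝ} (hP : P ∈ stdSimplex ℝ (U × V)) {Γ : X → Y → ℝ}
    (hΓ : ∀ x, Γ x ∈ stdSimplex ℝ Y) {δ : ℝ} (hδ : 0 < δ) :
    ∃ s : ℝ, 0 ≤ s ∧ ∀ (n : ℕ) (B ρ : ℝ) (f : (Fin n → U) → (Fin n → X))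
      (g : (Fin n → V) → (Fin n → Y) → Fin 2), 0 < B → 0 ≤ ρ →
      2 * ρ ≤ decisionProb P Γ f g 0 → expectedCost P c f ≤ ρ * B →
      ∃ x : Fin n → X, ∑ i, c (x i) ≤ B ∧
        ρ * Real.exp (-(s * B + n * δ)) ≤
          (∑ u : Fin n → U, if f u = x then ∏ i, margU P (u i) else 0) ∧
        ρ * Real.exp (-(s * B + n * δ)) ≤
          ∑ v : Fin n → V, (∏ i, margV P (v i)) * acceptProb Γ g x v := by
  obtain ⟨s, hs0, hs⟩ := exists_heavy_codeword (U := U) hc hc0 hδ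
  refine ⟨s, hs0, fun n B ρ f g hB hρ hacc hcost => ?_⟩
  have hPn : ∀ (u : Fin n → U) (v : Fin n → V), 0 ≤ ∏ i, P (u i, v i) := fun u v =>
    Finset.prod_nonneg fun i _ => hP.1 _
  set W : (Fin n → U) → ℝ := fun u => ∑ v : Fin n → V, (∏ i, P (u i, v i)) * acceptProb Γ g (f u) v
  have hW0 : ∀ u, 0 ≤ W u := fun u => Finset.sum_nonneg fun v _ =>
    mul_nonneg (hPn u v) (acceptProb_nonneg hΓ _ _)
  have hW1 : ∀ u, W u ≤ ∏ i, margU P (u i) := fun u => by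
    rw [← sum_snd_word_prod]
    exact Finset.sum_le_sum fun v _ => mul_le_of_le_one_right (hPn u v) (acceptProb_le_one hΓ _ _)
  obtain ⟨x, hxB, hx⟩ := hs n B ρ W f hB.le hρ (by
    have hm := sum_high_cost_le hc hP f hB hcost
    rw [decisionProb_zero] at hacc
    have : ∑ u, W u ≤ ∑ u, (if ∑ i, c (f u i) ≤ B then W u else 0) +
        ∑ u : Fin n → U, (if ∑ i, c (f u i) ≤ B then 0 else ∏ i, margU P (u i)) := by
      rw [← Finset.sum_add_distrib]
      refine Finset.sum_le_sum fun u _ => ?_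
      split_ifs
      · simp
      · simpa using hW1 u
    change 2 * ρ ≤ ∑ u, W u at hacc
    linarith)
  refine ⟨x, hxB, hx.trans ?_, hx.trans ?_⟩
  · refine Finset.sum_le_sum fun u _ => ?_
    split_ifs
    · exact hW1 u
    · exact le_rfl
  · calc ∑ u, (if f u = x then W u else 0)
        ≤ ∑ u : Fin n → U, ∑ v : Fin n → V, (∏ i, P (u i, v i)) * acceptProb Γ g x v := by
          refine Finset.sum_le_sum fun u _ => ?_
          split_ifs with h
          · simp only [W, h]; exact le_rfl
          · exact Finset.sum_nonneg fun v _ => mul_nonneg (hPn u v) (acceptProb_nonneg hΓ _ _)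
      _ = _ := by
          rw [Finset.sum_comm]
          refine Finset.sum_congr rfl fun v _ => ?_
          rw [← Finset.sum_mul, sum_fst_word_prod]

/-- Change of measure to the law under which `V` is i.i.d. `P_V`, `U` is drawn from the reverse
channel of `Q`, and the channel output is `Γ(·|0)`, whatever the codeword. The normalized
log-likelihood ratio against the law under hypothesis `1` exceeds `t` with exponentially small
probability. -/
theorem exists_change_of_measure [Zero X] {P Q : U × V → ℝ} (hP : P ∈ stdSimplex ℝ (U × V))
    (hQ : Q ∈ stdSimplex ℝ (U × V)) (hQp : ∀ w, 0 < Q w) {Γ : X → Y → ℝ}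
    (hΓ : ∀ x, Γ x ∈ stdSimplex ℝ Y) (hac : ∀ x y, Γ x y = 0 → Γ 0 y = 0) {t₁ t₂ t : ℝ}
    (ht₁ : klReal (margV P) (margV Q) < t₁) (ht₂ : ∀ x, klReal (Γ 0) (Γ x) < t₂)
    (ht : t₁ + t₂ < t) :
    ∃ γ > 0, ∀ (n : ℕ) (f : (Fin n → U) → (Fin n → X)) (g : (Fin n → V) → (Fin n → Y) → Fin 2),
      ∑ v : Fin n → V, (∏ i, margV P (v i)) * acceptProb Γ g (fun _ => 0) v ≤
        Real.exp (n * t) * decisionProb Q Γ f g 0 + Real.exp (-(n * γ)) := by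
  classical
  have hPV := margV_mem_stdSimplex hP
  set ℓ : V → ℝ := fun v => Real.log (margV P v / margV Q v) with hℓ
  set m : X → Y → ℝ := fun x y => Real.log (Γ 0 y / Γ x y) with hm
  obtain ⟨s, ⟨hs1, hs2⟩, hs0⟩ := (((eventually_sum_mul_exp_lt hPV ℓ ht₁).and
    (eventually_all.2 fun x => eventually_sum_mul_exp_lt (hΓ 0) (m x) (ht₂ x))).and
    self_mem_nhdsWithin).exists
  have hs0 : 0 < s := hs0
  have hu : Nonempty (U × V) := by
    by_contra h
    rw [not_nonempty_iff] at h
    simpa using hQ.2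
  have hQV : ∀ v, 0 < margV Q v := fun v =>
    Finset.sum_pos (fun u _ => hQp _) ⟨hu.some.1, Finset.mem_univ _⟩
  refine ⟨s * (t - t₁ - t₂), by apply mul_pos hs0; linarith, fun n f g => ?_⟩
  set r : (Fin n → U) → (Fin n → V) → ℝ := fun u v => ∏ i, (Q (u i, v i) / margV Q (v i)) with hr
  have hr0 : ∀ u v, 0 ≤ r u v := fun u v =>
    Finset.prod_nonneg fun i _ => div_nonneg (hQp _).le (hQV _).le
  have hr1 : ∀ v, ∑ u, r u v = 1 := fun v => by
    rw [hr, sum_word_prod fun i u => Q (u, v i) / margV Q (v i)]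
    refine Finset.prod_eq_one fun i _ => ?_
    rw [← Finset.sum_div]
    exact div_self (hQV _).ne'
  have hPn : ∀ v : Fin n → V, 0 ≤ ∏ i, margV P (v i) := fun v => prod_word_nonneg hPV v
  set A : (Fin n → V) → (Fin n → Y) → ℝ := fun v y => (∏ i, margV P (v i)) * ∏ i, Γ 0 (y i) with hA
  have hA0 : ∀ v y, 0 ≤ A v y := fun v y =>
    mul_nonneg (hPn v) (prod_channel_nonneg hΓ (fun _ => 0) y)
  set L : (Fin n → U) → (Fin n → V) → (Fin n → Y) → ℝ := fun u v y =>
    ∑ i, (ℓ (v i) + m (f u i) (y i)) with hL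
  -- The new law is at most `exp L` times the law under hypothesis `1`.
  have hdens : ∀ u v y, r u v * A v y ≤
      (∏ i, Q (u i, v i)) * (∏ i, Γ (f u i) (y i)) * Real.exp (L u v y) := by
    intro u v y
    simp only [hr, hA, hL, Real.exp_sum, ← Finset.prod_mul_distrib]
    refine Finset.prod_le_prod (fun i _ => mul_nonneg (div_nonneg (hQp _).le (hQV _).le)
      (mul_nonneg (hPV.1 _) ((hΓ 0).1 _))) fun i _ => ?_
    rw [Real.exp_add]
    have e1 : margV P (v i) / margV Q (v i) ≤ Real.exp (ℓ (v i)) := by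
      rcases (hPV.1 (v i)).eq_or_lt with h | h
      · rw [← h, zero_div]; exact (Real.exp_pos _).le
      · rw [hℓ, Real.exp_log (div_pos h (hQV _))]
    have e2 : Γ 0 (y i) ≤ Γ (f u i) (y i) * Real.exp (m (f u i) (y i)) := by
      rcases ((hΓ 0).1 (y i)).eq_or_lt with h | h
      · rw [← h]; exact mul_nonneg ((hΓ _).1 _) (Real.exp_pos _).le
      · have h' : 0 < Γ (f u i) (y i) :=
          lt_of_le_of_ne ((hΓ _).1 _) fun h'' => h.ne' (hac _ _ h''.symm)
        rw [hm, Real.exp_log (div_pos h h'), mul_div_cancel₀ _ h'.ne']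
    calc Q (u i, v i) / margV Q (v i) * (margV P (v i) * Γ 0 (y i))
        = Q (u i, v i) * ((margV P (v i) / margV Q (v i)) * Γ 0 (y i)) := by
          have := (hQV (v i)).ne'
          field_simp
      _ ≤ Q (u i, v i) * (Real.exp (ℓ (v i)) *
          (Γ (f u i) (y i) * Real.exp (m (f u i) (y i)))) := by
          refine mul_le_mul_of_nonneg_left ?_ (hQp _).le
          exact mul_le_mul e1 e2 ((hΓ 0).1 _) (Real.exp_pos _).le
      _ = _ := by ring
  have hpt : ∀ u v y, r u v * A v y ≤
      Real.exp (n * t) * ((∏ i, Q (u i, v i)) * (∏ i, Γ (f u i) (y i))) +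
        r u v * A v y * Real.exp (s * (L u v y - n * t)) := by
    intro u v y
    have hμ := mul_nonneg (hr0 u v) (hA0 v y)
    have hν : 0 ≤ (∏ i, Q (u i, v i)) * (∏ i, Γ (f u i) (y i)) :=
      mul_nonneg (Finset.prod_nonneg fun i _ => (hQp _).le) (prod_channel_nonneg hΓ _ _)
    by_cases h : L u v y ≤ n * t
    · have h1 : r u v * A v y ≤
          Real.exp (n * t) * ((∏ i, Q (u i, v i)) * (∏ i, Γ (f u i) (y i))) := by
        refine (hdens u v y).trans ?_
        rw [mul_comm]
        gcongr
      have h2 := mul_nonneg hμ (Real.exp_pos (s * (L u v y - n * t))).le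
      linarith
    · have h1 : 1 ≤ Real.exp (s * (L u v y - n * t)) :=
        Real.one_le_exp (mul_nonneg hs0.le (by linarith))
      have h2 := mul_le_mul_of_nonneg_left h1 hμ
      have h3 := mul_nonneg (Real.exp_pos (n * t)).le hν
      linarith
  have hmoment : ∑ u, ∑ v, ∑ y, r u v * A v y * Real.exp (s * (L u v y - n * t)) ≤
      Real.exp (-(n * (s * (t - t₁ - t₂)))) := by
    have hsp : ∀ u v y, r u v * A v y * Real.exp (s * (L u v y - n * t)) =
        Real.exp (-(s * (n * t))) * (r u v * (∏ i, margV P (v i) * Real.exp (s * ℓ (v i))) *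
          ∏ i, Γ 0 (y i) * Real.exp (s * m (f u i) (y i))) := by
      intro u v y
      simp only [hA, hL, Finset.prod_mul_distrib, ← Real.exp_sum]
      rw [mul_sub, sub_eq_add_neg, Real.exp_add, Finset.sum_add_distrib, mul_add, Real.exp_add,
        Finset.mul_sum, Finset.mul_sum]
      ring
    have hy : ∀ u : Fin n → U, ∑ y : Fin n → Y, ∏ i, Γ 0 (y i) * Real.exp (s * m (f u i) (y i)) ≤
        Real.exp (s * t₂) ^ n := by
      intro u
      rw [sum_word_prod fun i y => Γ 0 y * Real.exp (s * m (f u i) y)]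
      calc _ ≤ ∏ _i : Fin n, Real.exp (s * t₂) := Finset.prod_le_prod
            (fun i _ => Finset.sum_nonneg fun y _ => mul_nonneg ((hΓ 0).1 _) (Real.exp_pos _).le)
            fun i _ => (hs2 (f u i)).le
        _ = _ := by simp
    have hprod0 : ∀ v : Fin n → V, 0 ≤ ∏ i, margV P (v i) * Real.exp (s * ℓ (v i)) := fun v =>
      Finset.prod_nonneg fun i _ => mul_nonneg (hPV.1 _) (Real.exp_pos _).le
    calc ∑ u, ∑ v, ∑ y, r u v * A v y * Real.exp (s * (L u v y - n * t))
        = Real.exp (-(s * (n * t))) * ∑ u, ∑ v, r u v *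
          (∏ i, margV P (v i) * Real.exp (s * ℓ (v i))) *
          ∑ y : Fin n → Y, ∏ i, Γ 0 (y i) * Real.exp (s * m (f u i) (y i)) := by
          simp only [hsp, Finset.mul_sum]
      _ ≤ Real.exp (-(s * (n * t))) * ∑ u, ∑ v, r u v *
          (∏ i, margV P (v i) * Real.exp (s * ℓ (v i))) * Real.exp (s * t₂) ^ n := by
          refine mul_le_mul_of_nonneg_left ?_ (Real.exp_pos _).le
          refine Finset.sum_le_sum fun u _ => Finset.sum_le_sum fun v _ => ?_
          exact mul_le_mul_of_nonneg_left (hy u) (mul_nonneg (hr0 u v) (hprod0 v))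
      _ = Real.exp (-(s * (n * t))) * ((∑ v, margV P v * Real.exp (s * ℓ v)) ^ n *
          Real.exp (s * t₂) ^ n) := by
          congr 1
          rw [Finset.sum_comm]
          simp only [← Finset.sum_mul, hr1, one_mul]
          rw [sum_word_prod fun _ v => margV P v * Real.exp (s * ℓ v)]
          simp
      _ ≤ Real.exp (-(s * (n * t))) * (Real.exp (s * t₁) ^ n * Real.exp (s * t₂) ^ n) := by
          gcongr
          exact Finset.sum_nonneg fun v _ => mul_nonneg (hPV.1 _) (Real.exp_pos _).le
      _ = _ := by
          rw [← Real.exp_nat_mul, ← Real.exp_nat_mul, ← Real.exp_add, ← Real.exp_add]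
          congr 1; ring
  have hLHS : ∑ v : Fin n → V, (∏ i, margV P (v i)) * acceptProb Γ g (fun _ => 0) v =
      ∑ u, ∑ v, ∑ y, if g v y = 0 then r u v * A v y else 0 := by
    rw [Finset.sum_comm]
    refine Finset.sum_congr rfl fun v _ => ?_
    rw [Finset.sum_comm, acceptProb, Finset.mul_sum]
    refine Finset.sum_congr rfl fun y _ => ?_
    split_ifs
    · rw [← Finset.sum_mul, hr1, one_mul]
    · simp
  rw [hLHS]
  refine le_trans ?_ (add_le_add_right hmoment _)
  rw [decisionProb, Finset.mul_sum, ← Finset.sum_add_distrib]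
  refine Finset.sum_le_sum fun u _ => ?_
  rw [Finset.mul_sum, ← Finset.sum_add_distrib]
  refine Finset.sum_le_sum fun v _ => ?_
  rw [Finset.mul_sum, ← Finset.sum_add_distrib]
  refine Finset.sum_le_sum fun y _ => ?_
  split_ifs
  · exact hpt u v y
  · rw [mul_zero, zero_add]
    exact mul_nonneg (mul_nonneg (hr0 u v) (hA0 v y)) (Real.exp_pos _).le

end Converse

/-! ### Exponents of sequences -/

section Exponents

theorem mul_exp_eq_exp_log_add {r : ℝ} (hr : 0 < r) (x : ℝ) :
    r * Real.exp x = Real.exp (Real.log r + x) := by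
  rw [Real.exp_add, Real.exp_log hr]

/-- A lower bound `exp (-(n κ + o(n)))` on error probabilities bounds their exponent by `κ`. -/
theorem exponent_le_of_eventually_le {β C : ℕ → ℝ} {θ κ A D : ℝ}
    (hC : Tendsto (fun n : ℕ => C n / n) atTop (nhds 0))
    (hθ : (θ : EReal) ≤ liminf (fun n : ℕ => ((-(1 / (n : ℝ)) : ℝ) : EReal) *
      ENNReal.log (ENNReal.ofReal (β n))) atTop)
    (hβ : ∀ᶠ n : ℕ in atTop, Real.exp (-(n * κ + A * C n + D)) ≤ β n) : θ ≤ κ := by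
  have hlim : Tendsto (fun n : ℕ => κ + A * (C n / n) + D / n) atTop (nhds κ) := by
    have := ((tendsto_const_nhds (x := κ)).add (hC.const_mul A)).add
      (tendsto_const_div_atTop_nhds_zero_nat D)
    simpa using this
  have hlim' : Tendsto (fun n : ℕ => ((κ + A * (C n / n) + D / n : ℝ) : EReal)) atTop
      (nhds (κ : EReal)) := EReal.tendsto_coe.2 hlim
  rw [← EReal.coe_le_coe_iff, ← hlim'.liminf_eq]
  refine hθ.trans (liminf_le_liminf ?_)
  filter_upwards [hβ, eventually_gt_atTop 0] with n hn hn0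
  have hn0 : (0 : ℝ) < n := Nat.cast_pos.2 hn0
  have hpos : 0 < β n := (Real.exp_pos _).trans_le hn
  rw [ENNReal.log_ofReal_of_pos hpos, ← EReal.coe_mul, EReal.coe_le_coe_iff]
  have h1 := (Real.le_log_iff_exp_le hpos).2 hn
  have h2 : κ + A * (C n / n) + D / n = 1 / n * (n * κ + A * C n + D) := by field_simp
  rw [h2, neg_mul, ← mul_neg]
  gcongr
  linarith

theorem le_exponent_of_eventually_le {β : ℕ → ℝ} {θ : ℝ}
    (hβ : ∀ᶠ n : ℕ in atTop, β n ≤ Real.exp (-(n * θ))) :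
    (θ : EReal) ≤ liminf (fun n : ℕ => ((-(1 / (n : ℝ)) : ℝ) : EReal) *
      ENNReal.log (ENNReal.ofReal (β n))) atTop := by
  refine le_liminf_of_le (by isBoundedDefault) ?_
  filter_upwards [hβ, eventually_gt_atTop 0] with n hn hn0
  have hn0 : (0 : ℝ) < n := Nat.cast_pos.2 hn0
  rcases le_or_gt (β n) 0 with h | hpos
  · have hneg : -(1 / (n : ℝ)) < 0 := by
      have : 0 < 1 / (n : ℝ) := by positivity
      linarith
    rw [ENNReal.ofReal_of_nonpos h, ENNReal.log_zero, EReal.coe_mul_bot_of_neg hneg]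
    exact le_top
  · rw [ENNReal.log_ofReal_of_pos hpos, ← EReal.coe_mul, EReal.coe_le_coe_iff]
    have h1 := (Real.log_le_iff_le_exp hpos).2 hn
    calc θ = 1 / n * (n * θ) := by field_simp
      _ ≤ 1 / n * (-Real.log (β n)) := by gcongr; linarith
      _ = _ := by ring

end Exponents

/-! ### Upper bounds on achievable exponents -/

section UpperBounds

variable {U V X Y : Type*} [Fintype U] [Fintype V] [Fintype Y]

/-- On a fully connected channel, replacing an input by the zero symbol changes the output
probabilities at most by a factor controlled by the cost of that input. -/
theorem exists_channel_comparison {X Y : Type*} [Fintype X] [Fintype Y] [Zero X] {Γ : X → Y → ℝ}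
    (hΓ : ∀ x, Γ x ∈ stdSimplex ℝ Y) (hconn : ¬ PartiallyConnected Γ) {c : X → ℝ}
    (hc : ∀ x, 0 ≤ c x) (hc0 : ∀ x, c x = 0 ↔ x = 0) : ∃ k : ℝ, 0 ≤ k ∧ ∀ x y,
      Γ x y ≤ Real.exp (k * c x) * Γ 0 y ∧ Γ 0 y ≤ Real.exp (k * c x) * Γ x y := by
  have hsupp : ∀ x x' y, 0 < Γ x y → 0 < Γ x' y := fun x x' y h =>
    lt_of_le_of_ne ((hΓ x').1 y) fun h' => hconn ⟨x, x', y, h, h'.symm⟩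
  have key : ∀ x x' z y, c z = 0 → x = x' → ∀ᶠ k : ℝ in atTop,
      Γ x y ≤ Real.exp (k * c z) * Γ x' y := by
    intro x x' z y hz hx
    subst hx
    simp [hz]
  have key' : ∀ x x' z y, 0 < c z → ∀ᶠ k : ℝ in atTop, Γ x y ≤ Real.exp (k * c z) * Γ x' y := by
    intro x x' z y hz
    rcases ((hΓ x').1 y).eq_or_lt with h | h
    · have : Γ x y = 0 := by
        by_contra hne
        exact (hsupp x x' y (lt_of_le_of_ne ((hΓ x).1 y) (Ne.symm hne))).ne h
      simp [this, ← h]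
    · exact ((Real.tendsto_exp_atTop.comp (tendsto_id.atTop_mul_const hz)).atTop_mul_const
        h).eventually_ge_atTop _
  have hall : ∀ᶠ k : ℝ in atTop, ∀ x y,
      Γ x y ≤ Real.exp (k * c x) * Γ 0 y ∧ Γ 0 y ≤ Real.exp (k * c x) * Γ x y := by
    refine eventually_all.2 fun x => eventually_all.2 fun y => ?_
    by_cases hx : x = 0
    · have := (hc0 x).2 hx
      exact (key x 0 x y this hx).and (key 0 x x y this hx.symm)
    · have : 0 < c x := lt_of_le_of_ne (hc x) fun h => hx ((hc0 x).1 h.symm)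
      exact (key' x 0 x y this).and (key' 0 x x y this)
  obtain ⟨k, hk, hk0⟩ := (hall.and (eventually_ge_atTop 0)).exists
  exact ⟨k, hk0, hk⟩

theorem acceptProb_le_of_forall_le {V X Y : Type*} [Fintype Y] {Γ : X → Y → ℝ}
    (hΓ : ∀ x, Γ x ∈ stdSimplex ℝ Y) {c : X → ℝ} {k B : ℝ} (hk : 0 ≤ k) {n : ℕ} {x z x' : Fin n → X}
    (hxx' : ∀ i y, Γ (x i) y ≤ Real.exp (k * c (z i)) * Γ (x' i) y) (hz : ∑ i, c (z i) ≤ B)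
    (g : (Fin n → V) → (Fin n → Y) → Fin 2) (v : Fin n → V) :
    acceptProb Γ g x v ≤ Real.exp (k * B) * acceptProb Γ g x' v := by
  rw [acceptProb, acceptProb, Finset.mul_sum]
  refine Finset.sum_le_sum fun y _ => ?_
  split_ifs
  · calc ∏ i, Γ (x i) (y i) ≤ ∏ i, Real.exp (k * c (z i)) * Γ (x' i) (y i) :=
          Finset.prod_le_prod (fun i _ => (hΓ _).1 _) fun i _ => hxx' i _
      _ = Real.exp (k * ∑ i, c (z i)) * ∏ i, Γ (x' i) (y i) := by
          rw [Finset.prod_mul_distrib, ← Real.exp_sum, Finset.mul_sum]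
      _ ≤ _ := by
          have := prod_channel_nonneg hΓ x' y
          gcongr
  · simp

variable {P Q : U × V → ℝ} {Γ : X → Y → ℝ} {c : X → ℝ} {C : ℕ → ℝ} {S : Set (Fin 2)} {ε θ : ℝ}

theorem eventually_accept (hΓ : ∀ x, Γ x ∈ stdSimplex ℝ Y) (hP : P ∈ stdSimplex ℝ (U × V))
    (hε1 : ε < 1) {f : ∀ n : ℕ, (Fin n → U) → (Fin n → X)}
    {g : ∀ n : ℕ, (Fin n → V) → (Fin n → Y) → Fin 2}
    (hα : limsup (fun n : ℕ => decisionProb P Γ (f n) (g n) 1) atTop ≤ ε) :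
    ∀ᶠ n in atTop, 2 * ((1 - ε) / 4) ≤ decisionProb P Γ (f n) (g n) 0 := by
  have hlt : limsup (fun n : ℕ => decisionProb P Γ (f n) (g n) 1) atTop < (1 + ε) / 2 := by linarith
  filter_upwards [eventually_lt_of_limsup_lt hlt (isBoundedUnder_of ⟨1, fun n => by
    have := decisionProb_add hΓ hP (f n) (g n)
    have := decisionProb_nonneg hΓ hP (f n) (g n) 0
    linarith⟩)] with n hn
  have := decisionProb_add hΓ hP (f n) (g n)
  linarith

variable [Fintype X] [Zero X]

/-- No code beats the minimal divergence with marginals `P_U`, `P_V`, whatever the channel. -/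
theorem exponent_le_exponentE1 (hP : P ∈ stdSimplex ℝ (U × V))
    (hQ : ∀ w, 0 < Q w) (hΓ : ∀ x, Γ x ∈ stdSimplex ℝ Y)
    (hc : ∀ x, 0 ≤ c x) (hc0 : ∀ x, c x = 0 ↔ x = 0) (hCtop : Tendsto C atTop atTop)
    (hCsub : Tendsto (fun n : ℕ => C n / n) atTop (nhds 0)) (hε1 : ε < 1) (hS : (0 : Fin 2) ∈ S)
    (hach : Achievable P Q Γ c C S ε θ) : θ ≤ (exponentE1 P Q).toReal := by
  classical
  obtain ⟨f, g, hcost, hα, hθ⟩ := hach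
  refine le_of_forall_pos_le_add fun η hη => ?_
  obtain ⟨K, hK, hrev⟩ := exists_reverse_hypercontractive (margU_mem_stdSimplex hP)
    (margV_mem_stdSimplex hP) hQ (half_pos hη)
  have hK' : (0 : ℝ) < K := Nat.cast_pos.2 (Nat.pos_of_ne_zero hK)
  obtain ⟨s, hs0, hs⟩ := exists_accepted_codeword hc hc0 hP hΓ (δ := η / 4 / K) (by positivity)
  set ρ := (1 - ε) / 4 with hρ
  have hρ0 : 0 < ρ := by rw [hρ]; linarith
  refine exponent_le_of_eventually_le (A := 2 * K * s / ρ) (D := -(2 * K * Real.log ρ)) hCsub hθ ?_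
  filter_upwards [eventually_accept hΓ hP hε1 hα, hCtop.eventually_gt_atTop 0,
    eventually_ge_atTop 1] with n hacc hCn hn
  obtain ⟨x, -, h1, h2⟩ := hs n (C n / ρ) ρ (f n) (g n) (by positivity) hρ0.le hacc (by
    rw [mul_div_cancel₀ _ hρ0.ne']
    simpa using hcost n hn 0 hS)
  refine le_trans (le_of_eq ?_) (le_decisionProb_of_codeword hΓ hK (margU_mem_stdSimplex hP).1
    (margV_mem_stdSimplex hP).1 (fun w => (hQ w).le) hrev (f n) (g n) x (by positivity) h1 h2)
  rw [mul_exp_eq_exp_log_add hρ0, ← Real.exp_nat_mul, ← Real.exp_add, ← Real.exp_add]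
  congr 1
  simp only [exponentE1]
  field_simp
  ring

/-- On a fully connected channel, a constraint under the hypothesis with source law `R` lets some
cheap codeword be frequent under `R`; the receiver accepts it almost as often as the accepted
codeword found under `P`, because both are close to the zero word. -/
theorem exponent_le_of_fullyConnected (hP : P ∈ stdSimplex ℝ (U × V))
    (hQ : ∀ w, 0 < Q w) (hΓ : ∀ x, Γ x ∈ stdSimplex ℝ Y)
    (hc : ∀ x, 0 ≤ c x) (hc0 : ∀ x, c x = 0 ↔ x = 0) (hCtop : Tendsto C atTop atTop)
    (hCsub : Tendsto (fun n : ℕ => C n / n) atTop (nhds 0)) (hε0 : 0 ≤ ε) (hε1 : ε < 1)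
    (hS : (0 : Fin 2) ∈ S) (hconn : ¬ PartiallyConnected Γ) {h : Fin 2} (hh : h ∈ S)
    (hR : ![P, Q] h ∈ stdSimplex ℝ (U × V)) (hach : Achievable P Q Γ c C S ε θ) :
    θ ≤ (minDivergence (margU (![P, Q] h)) (margV P) Q).toReal := by
  classical
  obtain ⟨f, g, hcost, hα, hθ⟩ := hach
  set R := ![P, Q] h with hRdef
  refine le_of_forall_pos_le_add fun η hη => ?_
  obtain ⟨K, hK, hrev⟩ := exists_reverse_hypercontractive (margU_mem_stdSimplex hR)
    (margV_mem_stdSimplex hP) hQ (half_pos hη)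
  have hK' : (0 : ℝ) < K := Nat.cast_pos.2 (Nat.pos_of_ne_zero hK)
  obtain ⟨s, hs0, hs⟩ := exists_accepted_codeword hc hc0 hP hΓ (δ := η / 4 / K) (by positivity)
  obtain ⟨s', hs0', hs'⟩ := exists_heavy_codeword (U := U) hc hc0 (δ := η / 4 / K) (by positivity)
  obtain ⟨k, hk0, hk⟩ := exists_channel_comparison hΓ hconn hc hc0
  set ρ := (1 - ε) / 4 with hρ
  have hρ0 : 0 < ρ := by rw [hρ]; linarith
  refine exponent_le_of_eventually_le (A := 2 * K * (s + s' + 2 * k) / ρ)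
    (D := -(2 * K * Real.log ρ)) hCsub hθ ?_
  filter_upwards [eventually_accept hΓ hP hε1 hα, hCtop.eventually_gt_atTop 0,
    eventually_ge_atTop 1] with n hacc hCn hn
  set B := C n / ρ with hB
  have hB0 : 0 < B := by positivity
  have hρB : ρ * B = C n := mul_div_cancel₀ _ hρ0.ne'
  obtain ⟨x, hxB, h1, h2⟩ := hs n B ρ (f n) (g n) hB0 hρ0.le hacc (by
    rw [hρB]; simpa using hcost n hn 0 hS)
  obtain ⟨z, hzB, h3⟩ := hs' n B ρ (fun u => ∏ i, margU R (u i)) (f n) hB0.le hρ0.le (by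
    have hm := sum_high_cost_le hc hR (f n) hB0 (ρ := ρ) (by rw [hρB]; exact hcost n hn h hh)
    have : ∑ u : Fin n → U, ∏ i, margU R (u i) =
        ∑ u : Fin n → U, (if ∑ i, c (f n u i) ≤ B then ∏ i, margU R (u i) else 0) +
        ∑ u : Fin n → U, (if ∑ i, c (f n u i) ≤ B then 0 else ∏ i, margU R (u i)) := by
      rw [← Finset.sum_add_distrib]
      refine Finset.sum_congr rfl fun u _ => ?_
      split_ifs <;> simp
    rw [sum_word_iid (margU_mem_stdSimplex hR)] at this
    linarith)
  -- Passing from `x` to the zero word and on to `z` costs a factor `exp (2 k B)`.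
  have h4 : ρ * Real.exp (-(s * B + n * (η / 4 / K))) * Real.exp (-(2 * k * B)) ≤
      ∑ v : Fin n → V, (∏ i, margV P (v i)) * acceptProb Γ (g n) z v := by
    have : ∑ v : Fin n → V, (∏ i, margV P (v i)) * acceptProb Γ (g n) x v ≤
        Real.exp (2 * k * B) *
          ∑ v : Fin n → V, (∏ i, margV P (v i)) * acceptProb Γ (g n) z v := by
      rw [Finset.mul_sum]
      refine Finset.sum_le_sum fun v _ => ?_
      rw [mul_left_comm]
      refine mul_le_mul_of_nonneg_left ?_ (prod_word_nonneg (margV_mem_stdSimplex hP) v)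
      have e1 := acceptProb_le_of_forall_le (x := x) (x' := fun _ => 0) (z := x) hΓ hk0
        (fun i y => (hk (x i) y).1) hxB (g n) v
      have e2 := acceptProb_le_of_forall_le (x := fun _ => 0) (x' := z) (z := z) hΓ hk0
        (fun i y => (hk (z i) y).2) hzB (g n) v
      calc _ ≤ _ := e1
        _ ≤ Real.exp (k * B) * (Real.exp (k * B) * acceptProb Γ (g n) z v) := by gcongr
        _ = _ := by rw [← mul_assoc, ← Real.exp_add]; congr 2; ring
    have h5 := mul_le_mul_of_nonneg_right (h2.trans this) (Real.exp_pos (-(2 * k * B))).le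
    refine h5.trans (le_of_eq ?_)
    rw [mul_right_comm, ← Real.exp_add]; simp
  set l := ρ * Real.exp (-((s + s' + 2 * k) * B + n * (η / 4 / K))) with hl
  have hl1 : l ≤ ∑ u : Fin n → U, if f n u = z then ∏ i, margU R (u i) else 0 := by
    refine le_trans ?_ h3
    rw [hl]
    have e1 : 0 ≤ s * B := by positivity
    have e2 : 0 ≤ k * B := by positivity
    gcongr
    linarith
  have hl2 : l ≤ ∑ v : Fin n → V, (∏ i, margV P (v i)) * acceptProb Γ (g n) z v := by
    refine le_trans ?_ h4
    rw [hl, mul_assoc, ← Real.exp_add]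
    have e1 : 0 ≤ s' * B := by positivity
    gcongr
    linarith
  refine le_trans (le_of_eq ?_) (le_decisionProb_of_codeword hΓ hK (margU_mem_stdSimplex hR).1
    (margV_mem_stdSimplex hP).1 (fun w => (hQ w).le) hrev (f n) (g n) z (by positivity) hl1 hl2)
  rw [hl]
  rw [mul_exp_eq_exp_log_add hρ0, ← Real.exp_nat_mul, ← Real.exp_add, ← Real.exp_add]
  congr 1
  rw [hB]
  field_simp
  ring

/-- On a fully connected channel the receiver can do no better than to discriminate `(V, Y)` with
law `P_V ⊗ Γ(·|0)` from `Q_V ⊗ Γ(·|x)` with the most favourable `x`. -/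
theorem exponent_le_of_klReal_lt (hP : P ∈ stdSimplex ℝ (U × V))
    (hQ : Q ∈ stdSimplex ℝ (U × V)) (hQp : ∀ w, 0 < Q w) (hΓ : ∀ x, Γ x ∈ stdSimplex ℝ Y)
    (hc : ∀ x, 0 ≤ c x) (hc0 : ∀ x, c x = 0 ↔ x = 0) (hCtop : Tendsto C atTop atTop)
    (hCsub : Tendsto (fun n : ℕ => C n / n) atTop (nhds 0)) (hε1 : ε < 1)
    (hS : (0 : Fin 2) ∈ S) (hconn : ¬ PartiallyConnected Γ) {t₁ t₂ t : ℝ}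
    (ht₁ : klReal (margV P) (margV Q) < t₁) (ht₂ : ∀ x, klReal (Γ 0) (Γ x) < t₂)
    (ht : t₁ + t₂ < t) (hach : Achievable P Q Γ c C S ε θ) : θ ≤ t := by
  classical
  obtain ⟨f, g, hcost, hα, hθ⟩ := hach
  have hac : ∀ x y, Γ x y = 0 → Γ 0 y = 0 := fun x y h => by
    by_contra hne
    exact hconn ⟨0, x, y, lt_of_le_of_ne ((hΓ 0).1 y) (Ne.symm hne), h⟩
  obtain ⟨γ, hγ, hcm⟩ := exists_change_of_measure hP hQ hQp hΓ hac ht₁ ht₂ ht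
  refine le_of_forall_pos_le_add fun η hη => ?_
  set δ := min (γ / 2) η with hδ
  have hδ0 : 0 < δ := by positivity
  obtain ⟨s, hs0, hs⟩ := exists_accepted_codeword hc hc0 hP hΓ hδ0
  obtain ⟨k, hk0, hk⟩ := exists_channel_comparison hΓ hconn hc hc0
  set ρ := (1 - ε) / 4 with hρ
  have hρ0 : 0 < ρ := by rw [hρ]; linarith
  refine exponent_le_of_eventually_le (A := (s + k) / ρ) (D := -Real.log ρ + Real.log 2) hCsub hθ ?_
  -- The exceptional probability `exp (-n γ)` is negligible against the acceptance probability.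
  have hsmall : ∀ᶠ n : ℕ in atTop, (s + k) / ρ * C n - Real.log ρ + Real.log 2 ≤ n * (γ / 2) := by
    have hlim : Tendsto (fun n : ℕ => (s + k) / ρ * (C n / n) + (-Real.log ρ + Real.log 2) / n)
        atTop (nhds 0) := by
      have := (hCsub.const_mul ((s + k) / ρ)).add
        (tendsto_const_div_atTop_nhds_zero_nat (-Real.log ρ + Real.log 2))
      simpa using this
    filter_upwards [hlim.eventually (gt_mem_nhds (half_pos hγ)), eventually_gt_atTop 0]
      with n hn hn0
    have hn0 : (0 : ℝ) < n := Nat.cast_pos.2 hn0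
    have h1 := mul_le_mul_of_nonneg_left hn.le hn0.le
    refine le_trans (le_of_eq ?_) h1
    field_simp
    ring
  filter_upwards [eventually_accept hΓ hP hε1 hα, hCtop.eventually_gt_atTop 0,
    eventually_ge_atTop 1, hsmall] with n hacc hCn hn hsm
  set B := C n / ρ with hB
  have hB0 : 0 < B := by positivity
  have hρB : ρ * B = C n := mul_div_cancel₀ _ hρ0.ne'
  obtain ⟨x, hxB, -, h2⟩ := hs n B ρ (f n) (g n) hB0 hρ0.le hacc (by
    rw [hρB]; simpa using hcost n hn 0 hS)
  have hcm := hcm n (f n) (g n)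
  set lam := ∑ v : Fin n → V, (∏ i, margV P (v i)) * acceptProb Γ (g n) (fun _ => 0) v with hlam
  have h4 : ρ * Real.exp (-(s * B + n * δ)) ≤ Real.exp (k * B) * lam := by
    refine h2.trans ?_
    rw [hlam, Finset.mul_sum]
    refine Finset.sum_le_sum fun v _ => ?_
    rw [mul_left_comm]
    refine mul_le_mul_of_nonneg_left ?_ (prod_word_nonneg (margV_mem_stdSimplex hP) v)
    exact acceptProb_le_of_forall_le (z := x) hΓ hk0 (fun i y => (hk (x i) y).1) hxB (g n) v
  have h5 : Real.exp (Real.log ρ - (s + k) * B - n * δ) ≤ lam := by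
    have h6 := mul_le_mul_of_nonneg_left h4 (Real.exp_pos (-(k * B))).le
    rw [← mul_assoc (Real.exp _) (Real.exp _), ← Real.exp_add, neg_add_cancel, Real.exp_zero,
      one_mul] at h6
    refine le_trans (le_of_eq ?_) h6
    rw [mul_exp_eq_exp_log_add hρ0, ← Real.exp_add]
    congr 1; ring
  have hAB : (s + k) / ρ * C n = (s + k) * B := by rw [hB]; ring
  rw [hAB] at hsm ⊢
  have hδγ : n * δ ≤ n * (γ / 2) :=
    mul_le_mul_of_nonneg_left (min_le_left _ _) (Nat.cast_nonneg n)
  have hδη : n * δ ≤ n * η :=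
    mul_le_mul_of_nonneg_left (min_le_right _ _) (Nat.cast_nonneg n)
  have h7 : Real.exp (-(n * γ)) ≤ Real.exp (Real.log ρ - (s + k) * B - n * δ) / 2 := by
    rw [le_div_iff₀ two_pos, mul_comm, mul_exp_eq_exp_log_add two_pos]
    gcongr
    linarith
  have h8 : Real.exp (Real.log ρ - (s + k) * B - n * δ) / 2 ≤
      Real.exp (n * t) * decisionProb Q Γ (f n) (g n) 0 := by linarith
  have h9 := mul_le_mul_of_nonneg_left h8 (Real.exp_pos (-(n * t))).le
  rw [← mul_assoc (Real.exp _) (Real.exp _), ← Real.exp_add, neg_add_cancel, Real.exp_zero,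
    one_mul] at h9
  refine le_trans ?_ h9
  have h10 : ∀ r : ℝ, Real.exp r / 2 = Real.exp (r - Real.log 2) := fun r => by
    rw [Real.exp_sub, Real.exp_log two_pos]
  rw [h10, ← Real.exp_add]
  gcongr
  linarith

end UpperBounds

/-! ### Typical words -/

section Typical

/-- The words along which `h` has empirical mean at least `m`. -/
def typicalSet {α : Type*} (n : ℕ) (h : α → ℝ) (m : ℝ) : Set (Fin n → α) :=
  {w | n * m ≤ ∑ i, h (w i)}

open scoped Classical in
/-- Chernoff bound: the empirical mean of `h` falls `η` short of its expectation with exponentially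
small probability. -/
theorem exists_lower_tail_le {α : Type*} [Fintype α] {p : α → ℝ} (hp : p ∈ stdSimplex ℝ α)
    (h : α → ℝ) {η : ℝ} (hη : 0 < η) : ∃ r : ℝ, 0 ≤ r ∧ r < 1 ∧ ∀ n : ℕ,
      ∑ w : Fin n → α, (if w ∈ typicalSet n h (∑ a, p a * h a - η) then 0 else ∏ i, p (w i)) ≤
        r ^ n := by
  set t : ℝ := -(∑ a, p a * h a) + η with ht
  have hlt : ∑ a, p a * (-h a) < t := by
    simp only [mul_neg, Finset.sum_neg_distrib]; linarith
  obtain ⟨s, hs, hs0⟩ := ((eventually_sum_mul_exp_lt hp (fun a => -h a) hlt).and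
    self_mem_nhdsWithin).exists
  have hs0 : 0 < s := hs0
  have hnn : 0 ≤ ∑ a, p a * Real.exp (s * -h a) :=
    Finset.sum_nonneg fun a _ => mul_nonneg (hp.1 a) (Real.exp_pos _).le
  refine ⟨(∑ a, p a * Real.exp (s * -h a)) / Real.exp (s * t), by positivity,
    (div_lt_one (Real.exp_pos _)).2 hs, fun n => ?_⟩
  have key : ∀ w : Fin n → α,
      (if w ∈ typicalSet n h (∑ a, p a * h a - η) then 0 else ∏ i, p (w i)) ≤
      ∏ i, p (w i) * Real.exp (s * -h (w i)) / Real.exp (s * t) := by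
    intro w
    have h0 : 0 ≤ ∏ i, p (w i) := prod_word_nonneg hp w
    split_ifs with hw
    · exact Finset.prod_nonneg fun i _ =>
        div_nonneg (mul_nonneg (hp.1 _) (Real.exp_pos _).le) (Real.exp_pos _).le
    · rw [Finset.prod_div_distrib, Finset.prod_mul_distrib, ← Real.exp_sum, Finset.prod_const,
        Finset.card_univ, Fintype.card_fin, ← Real.exp_nat_mul, mul_div_assoc, ← Real.exp_sub]
      refine le_mul_of_one_le_right h0 (Real.one_le_exp ?_)
      rw [← Finset.mul_sum, Finset.sum_neg_distrib]
      have : ∑ i, h (w i) < n * (∑ a, p a * h a - η) := not_le.1 hw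
      have : n * (s * t) = s * (-(n * (∑ a, p a * h a - η))) := by rw [ht]; ring
      rw [this, ← mul_sub]
      exact mul_nonneg hs0.le (by linarith)
  refine (Finset.sum_le_sum fun w _ => key w).trans (le_of_eq ?_)
  rw [sum_word_prod fun _ a => p a * Real.exp (s * -h a) / Real.exp (s * t), Finset.prod_const,
    Finset.card_univ, Fintype.card_fin, ← Finset.sum_div]

open scoped Classical in
theorem sum_upper_tail_le {α : Type*} [Fintype α] {n : ℕ} {q : Fin n → α → ℝ}
    (hq : ∀ i a, 0 ≤ q i a) (h : α → ℝ) {m z : ℝ}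
    (hz : ∀ i, ∑ a, q i a * Real.exp (h a) ≤ Real.exp z) :
    ∑ w : Fin n → α, (if w ∈ typicalSet n h m then ∏ i, q i (w i) else 0) ≤
      Real.exp (-(n * (m - z))) := by
  have key : ∀ w : Fin n → α, (if w ∈ typicalSet n h m then ∏ i, q i (w i) else 0) ≤
      Real.exp (-(n * m)) * ∏ i, q i (w i) * Real.exp (h (w i)) := by
    intro w
    have h0 : 0 ≤ ∏ i, q i (w i) := Finset.prod_nonneg fun i _ => hq i _
    rw [Finset.prod_mul_distrib, ← Real.exp_sum, mul_left_comm, ← Real.exp_add]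
    split_ifs with hw
    · exact le_mul_of_one_le_right h0 (Real.one_le_exp (by linarith [show n * m ≤ _ from hw]))
    · exact mul_nonneg h0 (Real.exp_pos _).le
  refine (Finset.sum_le_sum fun w _ => key w).trans ?_
  rw [← Finset.mul_sum, sum_word_prod fun i a => q i a * Real.exp (h a)]
  calc _ ≤ Real.exp (-(n * m)) * ∏ _i : Fin n, Real.exp z := by
        refine mul_le_mul_of_nonneg_left ?_ (Real.exp_pos _).le
        exact Finset.prod_le_prod (fun i _ => Finset.sum_nonneg fun a _ =>
          mul_nonneg (hq i a) (Real.exp_pos _).le) fun i _ => hz i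
    _ = _ := by
        rw [Finset.prod_const, Finset.card_univ, Fintype.card_fin, ← Real.exp_nat_mul,
          ← Real.exp_add]
        congr 1; ring

open scoped Classical in
theorem sum_pair_upper_tail_le {U V : Type*} [Fintype U] [Fintype V] {Q : U × V → ℝ}
    (hQ : ∀ w, 0 ≤ Q w) (φ : U → ℝ) (ψ : V → ℝ) {m₁ m₂ z : ℝ}
    (hz : ∑ w : U × V, Q w * Real.exp (φ w.1 + ψ w.2) ≤ Real.exp z) (n : ℕ) :
    ∑ u : Fin n → U, ∑ v : Fin n → V, (if u ∈ typicalSet n φ m₁ ∧ v ∈ typicalSet n ψ m₂ then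
      ∏ i, Q (u i, v i) else 0) ≤ Real.exp (-(n * (m₁ + m₂ - z))) := by
  have key : ∀ (u : Fin n → U) (v : Fin n → V),
      (if u ∈ typicalSet n φ m₁ ∧ v ∈ typicalSet n ψ m₂ then ∏ i, Q (u i, v i) else 0) ≤
      Real.exp (-(n * (m₁ + m₂))) * ∏ i, Q (u i, v i) * Real.exp (φ (u i) + ψ (v i)) := by
    intro u v
    have h0 : 0 ≤ ∏ i, Q (u i, v i) := Finset.prod_nonneg fun i _ => hQ _
    rw [Finset.prod_mul_distrib, ← Real.exp_sum, mul_left_comm, ← Real.exp_add,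
      Finset.sum_add_distrib]
    split_ifs with hw
    · exact le_mul_of_one_le_right h0 (Real.one_le_exp (by
        linarith [show n * m₁ ≤ _ from hw.1, show n * m₂ ≤ _ from hw.2]))
    · exact mul_nonneg h0 (Real.exp_pos _).le
  refine (Finset.sum_le_sum fun u _ => Finset.sum_le_sum fun v _ => key u v).trans ?_
  simp only [← Finset.mul_sum]
  rw [sum_pair_word_prod fun w : U × V => Q w * Real.exp (φ w.1 + ψ w.2)]
  calc _ ≤ Real.exp (-(n * (m₁ + m₂))) * Real.exp z ^ n := by
        have : 0 ≤ ∑ w : U × V, Q w * Real.exp (φ w.1 + ψ w.2) :=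
          Finset.sum_nonneg fun w _ => mul_nonneg (hQ w) (Real.exp_pos _).le
        gcongr
    _ = _ := by
        rw [← Real.exp_nat_mul, ← Real.exp_add]
        congr 1; ring

end Typical

/-! ### Codes with two codewords -/

section TwoWords

variable {U V X Y : Type*} {n : ℕ}

open scoped Classical in
/-- The encoder that sends `x` when the source word lies in `A`, and `z` otherwise. -/
noncomputable def twoWordEncoder (A : Set (Fin n → U)) (x z : Fin n → X) :
    (Fin n → U) → (Fin n → X) := fun u => if u ∈ A then x else z

open scoped Classical in
/-- The decoder that decides `0` exactly when the side information lies in `B` and the channel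
output in `D`. -/
noncomputable def rectangleDecoder (B : Set (Fin n → V)) (D : Set (Fin n → Y)) :
    (Fin n → V) → (Fin n → Y) → Fin 2 := fun v y => if v ∈ B ∧ y ∈ D then 0 else 1

variable [Fintype U] [Fintype V] [Fintype Y] {Γ : X → Y → ℝ}

open scoped Classical in
theorem decisionProb_one_twoWord_le (hΓ : ∀ x, Γ x ∈ stdSimplex ℝ Y) {P : U × V → ℝ}
    (hP : P ∈ stdSimplex ℝ (U × V)) (A : Set (Fin n → U)) (x z : Fin n → X)
    (B : Set (Fin n → V)) (D : Set (Fin n → Y)) :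
    decisionProb P Γ (twoWordEncoder A x z) (rectangleDecoder B D) 1 ≤
      ∑ u : Fin n → U, (if u ∈ A then 0 else ∏ i, margU P (u i)) +
      ∑ v : Fin n → V, (if v ∈ B then 0 else ∏ i, margV P (v i)) +
      ∑ y : Fin n → Y, (if y ∈ D then 0 else ∏ i, Γ (x i) (y i)) := by
  have hPn : ∀ (u : Fin n → U) (v : Fin n → V), 0 ≤ ∏ i, P (u i, v i) := fun u v =>
    Finset.prod_nonneg fun i _ => hP.1 _
  set p : (Fin n → U) → (Fin n → V) → ℝ := fun u v => ∏ i, P (u i, v i) with hp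
  set w : (Fin n → U) → (Fin n → Y) → ℝ := fun u y => ∏ i, Γ (twoWordEncoder A x z u i) (y i)
  have hw : ∀ u y, 0 ≤ w u y := fun u y => prod_channel_nonneg hΓ _ _
  have hw1 : ∀ u, ∑ y, w u y = 1 := fun u => sum_prod_channel hΓ _
  set e : ℝ := ∑ y : Fin n → Y, (if y ∈ D then 0 else ∏ i, Γ (x i) (y i))
  have key : ∀ u v, ∑ y, (if rectangleDecoder B D v y = 1 then p u v * w u y else 0) ≤
      (if u ∈ A then 0 else p u v) + (if v ∈ B then 0 else p u v) + p u v * e := by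
    intro u v
    have he : 0 ≤ e := Finset.sum_nonneg fun y _ => by
      split_ifs
      · exact le_rfl
      · exact prod_channel_nonneg hΓ _ _
    have hpe := mul_nonneg (hPn u v) he
    have hle : ∑ y, (if rectangleDecoder B D v y = 1 then p u v * w u y else 0) ≤ p u v := by
      calc _ ≤ ∑ y, p u v * w u y := Finset.sum_le_sum fun y _ => by
            split_ifs
            · exact le_rfl
            · exact mul_nonneg (hPn u v) (hw u y)
        _ = p u v := by rw [← Finset.mul_sum, hw1, mul_one]
    by_cases hu : u ∈ A
    · by_cases hv : v ∈ B
      · simp only [if_pos hu, if_pos hv, zero_add]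
        rw [Finset.mul_sum]
        refine Finset.sum_le_sum fun y _ => ?_
        by_cases hy : y ∈ D
        · simp [rectangleDecoder, hv, hy]
        · simp [rectangleDecoder, hy, w, twoWordEncoder, hu]
      · simp only [if_pos hu, if_neg hv, zero_add]
        linarith
    · simp only [if_neg hu]
      have : 0 ≤ if v ∈ B then 0 else p u v := by split_ifs <;> simp [hp, hPn]
      linarith
  rw [decisionProb]
  refine (Finset.sum_le_sum fun u _ => Finset.sum_le_sum fun v _ => key u v).trans (le_of_eq ?_)
  simp only [Finset.sum_add_distrib, ← Finset.sum_mul]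
  congr 1
  · congr 1
    · refine Finset.sum_congr rfl fun u _ => ?_
      split_ifs
      · simp
      · exact sum_snd_word_prod P u
    · rw [Finset.sum_comm]
      refine Finset.sum_congr rfl fun v _ => ?_
      split_ifs
      · simp
      · exact sum_fst_word_prod P v
  · rw [sum_pair_word_prod, hP.2, one_pow, one_mul]

open scoped Classical in
theorem decisionProb_zero_twoWord_le (hΓ : ∀ x, Γ x ∈ stdSimplex ℝ Y) {Q : U × V → ℝ}
    (hQ : ∀ w, 0 ≤ Q w) (A : Set (Fin n → U)) (x z : Fin n → X)
    (B : Set (Fin n → V)) (D : Set (Fin n → Y)) :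
    decisionProb Q Γ (twoWordEncoder A x z) (rectangleDecoder B D) 0 ≤
      ∑ u : Fin n → U, ∑ v : Fin n → V, (if u ∈ A ∧ v ∈ B then ∏ i, Q (u i, v i) else 0) +
      (∑ v : Fin n → V, if v ∈ B then ∏ i, margV Q (v i) else 0) *
        ∑ y : Fin n → Y, if y ∈ D then ∏ i, Γ (z i) (y i) else 0 := by
  have hQn : ∀ (u : Fin n → U) (v : Fin n → V), 0 ≤ ∏ i, Q (u i, v i) := fun u v =>
    Finset.prod_nonneg fun i _ => hQ _
  set q : (Fin n → U) → (Fin n → V) → ℝ := fun u v => ∏ i, Q (u i, v i) with hq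
  set e : ℝ := ∑ y : Fin n → Y, if y ∈ D then ∏ i, Γ (z i) (y i) else 0
  have he : 0 ≤ e := Finset.sum_nonneg fun y _ => by
    split_ifs
    · exact prod_channel_nonneg hΓ _ _
    · exact le_rfl
  rw [decisionProb_zero]
  have key : ∀ u v, q u v * acceptProb Γ (rectangleDecoder B D) (twoWordEncoder A x z u) v ≤
      (if u ∈ A ∧ v ∈ B then q u v else 0) + (if v ∈ B then q u v else 0) * e := by
    intro u v
    by_cases hv : v ∈ B
    · by_cases hu : u ∈ A
      · simp only [hu, hv, and_self, if_true]
        have h1 := mul_le_mul_of_nonneg_left (acceptProb_le_one (g := rectangleDecoder B D) hΓ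
          (twoWordEncoder A x z u) v) (hQn u v)
        have h2 := mul_nonneg (hQn u v) he
        rw [mul_one] at h1
        linarith
      · simp [hu, hv, acceptProb, rectangleDecoder, twoWordEncoder, e]
    · simp [hv, acceptProb, rectangleDecoder]
  refine (Finset.sum_le_sum fun u _ => Finset.sum_le_sum fun v _ => key u v).trans (le_of_eq ?_)
  simp only [Finset.sum_add_distrib, ← Finset.sum_mul]
  congr 2
  rw [Finset.sum_comm]
  refine Finset.sum_congr rfl fun v _ => ?_
  split_ifs
  · exact sum_fst_word_prod Q v
  · simp

end TwoWords

/-! ### Achievability -/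

section Achievability

variable {U V X Y : Type*} [Fintype U] [Fintype V] [Fintype Y] [Zero X]
  {P Q : U × V → ℝ} {Γ : X → Y → ℝ} {c : X → ℝ} {C : ℕ → ℝ} {S : Set (Fin 2)} {ε θ : ℝ}

/-- It suffices to provide codes for all large blocklengths: at the others, the zero word is sent
at no cost. -/
theorem achievable_of_eventually (hΓ : ∀ x, Γ x ∈ stdSimplex ℝ Y) (hP : P ∈ stdSimplex ℝ (U × V))
    (hc0 : c 0 = 0) (hC : ∀ n, 1 ≤ n → 0 ≤ C n) (hε0 : 0 ≤ ε) {e : ℕ → ℝ}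
    (he : Tendsto e atTop (nhds 0))
    (hcode : ∀ᶠ n : ℕ in atTop, ∃ (f : (Fin n → U) → (Fin n → X))
      (g : (Fin n → V) → (Fin n → Y) → Fin 2), (∀ h ∈ S, expectedCost (![P, Q] h) c f ≤ C n) ∧
        decisionProb P Γ f g 1 ≤ e n ∧ decisionProb Q Γ f g 0 ≤ Real.exp (-(n * θ))) :
    Achievable P Q Γ c C S ε θ := by
  classical
  set good : ∀ n : ℕ, ((Fin n → U) → (Fin n → X)) × ((Fin n → V) → (Fin n → Y) → Fin 2) → Prop :=
    fun n fg => (∀ h ∈ S, expectedCost (![P, Q] h) c fg.1 ≤ C n) ∧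
      decisionProb P Γ fg.1 fg.2 1 ≤ e n ∧ decisionProb Q Γ fg.1 fg.2 0 ≤ Real.exp (-(n * θ))
  have hex : ∀ n : ℕ, ∃ fg : ((Fin n → U) → (Fin n → X)) × ((Fin n → V) → (Fin n → Y) → Fin 2),
      (1 ≤ n → ∀ h ∈ S, expectedCost (![P, Q] h) c fg.1 ≤ C n) ∧
      ((∃ fg', good n fg') → good n fg) := by
    intro n
    by_cases h : ∃ fg', good n fg'
    · obtain ⟨fg, hfg⟩ := h
      exact ⟨fg, fun _ => hfg.1, fun _ => hfg⟩
    · refine ⟨(fun _ _ => 0, fun _ _ => 0), fun hn h' _ => ?_, fun h' => absurd h' h⟩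
      simpa [expectedCost, hc0] using hC n hn
  choose fg hfg1 hfg2 using hex
  have hev : ∀ᶠ n in atTop, good n (fg n) := by
    filter_upwards [hcode] with n hn
    obtain ⟨f, g, h⟩ := hn
    exact hfg2 n ⟨(f, g), h⟩
  refine ⟨fun n => (fg n).1, fun n => (fg n).2, hfg1, ?_, ?_⟩
  · have : Tendsto (fun n : ℕ => decisionProb P Γ (fg n).1 (fg n).2 1) atTop (nhds 0) :=
      tendsto_of_tendsto_of_tendsto_of_le_of_le' tendsto_const_nhds he
        (Eventually.of_forall fun n => decisionProb_nonneg hΓ hP _ _ _)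
        (hev.mono fun n hn => hn.2.1)
    rw [this.limsup_eq]
    exact hε0
  · exact le_exponent_of_eventually_le (hev.mono fun n hn => hn.2.2)

open scoped Classical in
/-- On a partially connected channel, a slowly growing number of channel uses carries the bit
"`u` is typical" with a one-sided error: an output that `x₁` cannot produce proves that `x₀` was
sent. -/
theorem achievable_of_partiallyConnected [Fintype X] (hP : P ∈ stdSimplex ℝ (U × V))
    (hQ : Q ∈ stdSimplex ℝ (U × V)) (hQp : ∀ w, 0 < Q w) (hΓ : ∀ x, Γ x ∈ stdSimplex ℝ Y)
    (hc0 : c 0 = 0) (hC : ∀ n, 1 ≤ n → 0 ≤ C n) (hCtop : Tendsto C atTop atTop) (hε0 : 0 ≤ ε)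
    (hconn : PartiallyConnected Γ) (hθ : θ < (exponentE1 P Q).toReal) :
    Achievable P Q Γ c C S ε θ := by
  obtain ⟨x₀, x₁, y₀, hx₀, hx₁⟩ := hconn
  set E := (exponentE1 P Q).toReal with hE
  set η := (E - θ) / 3 with hη
  have hη0 : 0 < η := by rw [hη]; linarith
  have hPU := margU_mem_stdSimplex hP
  have hPV := margV_mem_stdSimplex hP
  obtain ⟨φ, ψ, hφψ⟩ := exists_dual_potentials hPU hPV hQ hQp hη0
  obtain ⟨r₁, hr₁, hr₁', htail₁⟩ := exists_lower_tail_le hPU φ hη0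
  obtain ⟨r₂, hr₂, hr₂', htail₂⟩ := exists_lower_tail_le hPV ψ hη0
  obtain ⟨M, hM0, hM⟩ : ∃ M > 0, ∀ x, c x ≤ M := by
    obtain ⟨M, hM⟩ := (Set.finite_range c).bddAbove
    exact ⟨max M 1, by positivity, fun x => (hM ⟨x, rfl⟩).trans (le_max_left _ _)⟩
  set k : ℕ → ℕ := fun n => ⌊C n / M⌋₊ with hk
  set q : ℝ := 1 - Γ x₀ y₀ with hq
  have hq1 : q < 1 := by rw [hq]; linarith
  have hq0 : 0 ≤ q := by
    have : Γ x₀ y₀ ≤ 1 := by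
      rw [← (hΓ x₀).2]
      exact Finset.single_le_sum (fun y _ => (hΓ x₀).1 y) (Finset.mem_univ y₀)
    linarith
  have hmin : Tendsto (fun n => min n (k n)) atTop atTop :=
    tendsto_atTop.2 fun m => by
      filter_upwards [eventually_ge_atTop m, (tendsto_nat_floor_atTop.comp
        (hCtop.atTop_div_const hM0)).eventually_ge_atTop m] with n h1 h2
      exact le_min h1 h2
  have hlim : Tendsto (fun n => r₁ ^ n + r₂ ^ n + q ^ min n (k n)) atTop (nhds 0) := by
    have := ((tendsto_pow_atTop_nhds_zero_of_lt_one hr₁ hr₁').add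
      (tendsto_pow_atTop_nhds_zero_of_lt_one hr₂ hr₂')).add
      ((tendsto_pow_atTop_nhds_zero_of_lt_one hq0 hq1).comp hmin)
    simpa using this
  refine achievable_of_eventually hΓ hP hc0 hC hε0 hlim ?_
  filter_upwards [eventually_ge_atTop 1] with n hn
  set A := typicalSet n φ (∑ a, margU P a * φ a - η)
  set B := typicalSet n ψ (∑ a, margV P a * ψ a - η)
  obtain ⟨D, hD⟩ : ∃ D : Set (Fin n → Y), ∀ y, y ∈ D ↔ ∃ i : Fin n, (i : ℕ) < k n ∧ y i = y₀ :=
    ⟨{y | ∃ i : Fin n, (i : ℕ) < k n ∧ y i = y₀}, fun _ => Iff.rfl⟩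
  set word : X → Fin n → X := fun x i => if (i : ℕ) < k n then x else 0 with hword
  have hcard : (Finset.univ.filter fun i : Fin n => (i : ℕ) < k n).card = min n (k n) := by
    rw [Fin.card_filter_val_lt]
  have hwordcost : ∀ x, ∑ i, c (word x i) ≤ C n := by
    intro x
    calc ∑ i, c (word x i) ≤ ∑ i : Fin n, if (i : ℕ) < k n then M else 0 := by
          refine Finset.sum_le_sum fun i _ => ?_
          simp only [hword]
          split_ifs
          · exact hM x
          · exact hc0.le
      _ = (min n (k n) : ℕ) * M := by
          rw [← Finset.sum_filter, Finset.sum_const, hcard, nsmul_eq_mul]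
      _ ≤ k n * M := by
          gcongr
          exact min_le_right _ _
      _ ≤ C n / M * M := by
          gcongr
          exact Nat.floor_le (div_nonneg (hC n hn) hM0.le)
      _ = C n := div_mul_cancel₀ _ hM0.ne'
  refine ⟨twoWordEncoder A (word x₀) (word x₁), rectangleDecoder B D, fun h _ => ?_, ?_, ?_⟩
  · have hR : ![P, Q] h ∈ stdSimplex ℝ (U × V) := by fin_cases h <;> simp [hP, hQ]
    rw [expectedCost_eq]
    calc _ ≤ ∑ u : Fin n → U, (∏ j, margU (![P, Q] h) (u j)) * C n := by
          refine Finset.sum_le_sum fun u _ => mul_le_mul_of_nonneg_left ?_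
            (prod_word_nonneg (margU_mem_stdSimplex hR) u)
          simp only [twoWordEncoder]
          split_ifs
          · exact hwordcost x₀
          · exact hwordcost x₁
      _ = C n := by
          rw [← Finset.sum_mul, sum_word_iid (margU_mem_stdSimplex hR), one_mul]
  · refine (decisionProb_one_twoWord_le hΓ hP A _ _ B D).trans ?_
    refine add_le_add (add_le_add (htail₁ n) (htail₂ n)) (le_of_eq ?_)
    calc ∑ y : Fin n → Y, (if y ∈ D then 0 else ∏ i, Γ (word x₀ i) (y i))
        = ∑ y : Fin n → Y, ∏ i : Fin n,
          (if (i : ℕ) < k n ∧ y i = y₀ then 0 else Γ (word x₀ i) (y i)) := by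
          refine Finset.sum_congr rfl fun y _ => ?_
          split_ifs with hy
          · obtain ⟨i, hi⟩ := (hD y).1 hy
            symm
            refine Finset.prod_eq_zero (Finset.mem_univ i) ?_
            exact if_pos hi
          · refine Finset.prod_congr rfl fun i _ => ?_
            rw [if_neg fun hi => hy ((hD y).2 ⟨i, hi⟩)]
      _ = ∏ i : Fin n, if (i : ℕ) < k n then q else 1 := by
          rw [sum_word_prod fun (i : Fin n) y =>
            if (i : ℕ) < k n ∧ y = y₀ then 0 else Γ (word x₀ i) y]
          refine Finset.prod_congr rfl fun i _ => ?_
          by_cases hi : (i : ℕ) < k n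
          · have : ∀ y, (if y = y₀ then 0 else Γ x₀ y) = Γ x₀ y - if y = y₀ then Γ x₀ y else 0 := by
              intro y; split_ifs <;> simp
            simp [hi, hword, this, Finset.sum_sub_distrib, (hΓ x₀).2, hq]
          · simp [hi, hword, (hΓ 0).2]
      _ = q ^ min n (k n) := by
          rw [← Finset.prod_filter, Finset.prod_const, hcard]
  · refine (decisionProb_zero_twoWord_le hΓ (fun w => (hQp w).le) A _ _ B D).trans ?_
    have hzero : ∑ y : Fin n → Y, (if y ∈ D then ∏ i, Γ (word x₁ i) (y i) else 0) = 0 := by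
      refine Finset.sum_eq_zero fun y _ => ?_
      split_ifs with hy
      · obtain ⟨i, hi, hyi⟩ := (hD y).1 hy
        refine Finset.prod_eq_zero (Finset.mem_univ i) ?_
        simp only [hword, if_pos hi, hyi, hx₁]
      · rfl
    rw [hzero, mul_zero, add_zero]
    refine (sum_pair_upper_tail_le (fun w => (hQp w).le) φ ψ hφψ n).trans (le_of_eq ?_)
    congr 2
    have : (minDivergence (margU P) (margV P) Q).toReal = E := rfl
    rw [this, hη]
    ring

open scoped Classical in
/-- The sender stays silent when `u` is typical for one of the constrained hypotheses, and otherwise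
sends `x` throughout; the receiver tests `(v, y)` for typicality under `P_V ⊗ Γ(·|0)`. Under the
constrained hypotheses `x` is sent with exponentially small probability, which keeps the expected
cost bounded. -/
theorem achievable_of_lt (hP : P ∈ stdSimplex ℝ (U × V))
    (hQ : Q ∈ stdSimplex ℝ (U × V)) (hQp : ∀ w, 0 < Q w) (hΓ : ∀ x, Γ x ∈ stdSimplex ℝ Y)
    (hc0 : c 0 = 0) (hC : ∀ n, 1 ≤ n → 0 ≤ C n) (hCtop : Tendsto C atTop atTop) (hε0 : 0 ≤ ε)
    (hS : (0 : Fin 2) ∈ S)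
    (hθ : ∀ h ∈ S, θ < (minDivergence (margU (![P, Q] h)) (margV P) Q).toReal) {x : X}
    (hcx : 0 ≤ c x) (hac : ∀ y, Γ x y = 0 → Γ 0 y = 0)
    (hθ' : θ < klReal (margV P) (margV Q) + klReal (Γ 0) (Γ x)) :
    Achievable P Q Γ c C S ε θ := by
  have hR : ∀ h, ![P, Q] h ∈ stdSimplex ℝ (U × V) := by
    intro h; fin_cases h <;> simp [hP, hQ]
  have hPV := margV_mem_stdSimplex hP
  have hQV := margV_mem_stdSimplex hQ
  have hu : Nonempty (U × V) := by
    by_contra h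
    rw [not_nonempty_iff] at h
    simpa using hQ.2
  have hQVp : ∀ v, 0 < margV Q v := fun v =>
    Finset.sum_pos (fun u _ => hQp _) ⟨hu.some.1, Finset.mem_univ _⟩
  obtain ⟨η, hη0, hη1, hη2⟩ : ∃ η > 0, (∀ h ∈ S, θ + η ≤
      (minDivergence (margU (![P, Q] h)) (margV P) Q).toReal - 3 * η) ∧
      θ + η ≤ klReal (margV P) (margV Q) + klReal (Γ 0) (Γ x) - 4 * η := by
    have h1 : ∀ d : ℝ, θ < d → ∀ᶠ η in nhdsWithin (0 : ℝ) (Set.Ioi 0), θ + η ≤ d - 4 * η := by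
      intro d hd
      have : Tendsto (fun η : ℝ => θ + η + 4 * η) (nhdsWithin 0 (Set.Ioi 0)) (nhds θ) := by
        refine Tendsto.mono_left ?_ nhdsWithin_le_nhds
        have : Continuous fun η : ℝ => θ + η + 4 * η := by fun_prop
        simpa using this.tendsto 0
      filter_upwards [this.eventually (gt_mem_nhds hd)] with η hη
      linarith
    obtain ⟨η, ⟨h2, h3⟩, h4⟩ := (((eventually_all.2 fun h : S => h1 _ (hθ h h.2)).and
      (h1 _ hθ')).and self_mem_nhdsWithin).exists
    have h4 : 0 < η := h4
    exact ⟨η, h4, fun h hh => by linarith [h2 ⟨h, hh⟩], h3⟩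
  choose φ ψ hφψ using fun h : Fin 2 =>
    exists_dual_potentials (margU_mem_stdSimplex (hR h)) hPV hQ hQp hη0
  obtain ⟨a, ha, ha'⟩ := exists_test_klReal hPV hQV (fun v h => absurd h (hQVp v).ne') hη0
  obtain ⟨b, hb, hb'⟩ := exists_test_klReal (hΓ 0) (hΓ x) hac hη0
  choose r hr hr' htail using fun h => exists_lower_tail_le (margU_mem_stdSimplex (hR h)) (φ h) hη0
  choose s hs hs' htails using fun h => exists_lower_tail_le hPV (ψ h) hη0
  obtain ⟨ra, hra, hra', htaila⟩ := exists_lower_tail_le hPV a hη0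
  obtain ⟨rb, hrb, hrb', htailb⟩ := exists_lower_tail_le (hΓ 0) b hη0
  have hlim : Tendsto (fun n : ℕ => r 0 ^ n + (s 0 ^ n + s 1 ^ n + ra ^ n) + rb ^ n) atTop
      (nhds 0) := by
    have hp : ∀ {t : ℝ}, 0 ≤ t → t < 1 → Tendsto (fun n : ℕ => t ^ n) atTop (nhds 0) :=
      fun h h' => tendsto_pow_atTop_nhds_zero_of_lt_one h h'
    have := ((hp (hr 0) (hr' 0)).add (((hp (hs 0) (hs' 0)).add (hp (hs 1) (hs' 1))).add
      (hp hra hra'))).add (hp hrb hrb')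
    simpa using this
  have hcosts : ∀ᶠ n : ℕ in atTop, ∀ h, r h ^ n * (n * c x) ≤ C n := by
    refine eventually_all.2 fun h => ?_
    have h1 : Tendsto (fun n : ℕ => r h ^ n * (n * c x)) atTop (nhds 0) := by
      have := (tendsto_self_mul_const_pow_of_lt_one (hr h) (hr' h)).mul_const (c x)
      rw [zero_mul] at this
      refine this.congr fun n => by ring
    filter_upwards [h1.eventually (gt_mem_nhds one_pos), hCtop.eventually_ge_atTop 1] with n h2 h3
    linarith
  have hthree : ∀ᶠ n : ℕ in atTop, (3 : ℝ) ≤ Real.exp (n * η) :=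
    (Real.tendsto_exp_atTop.comp
      (tendsto_natCast_atTop_atTop.atTop_mul_const hη0)).eventually_ge_atTop 3
  refine achievable_of_eventually hΓ hP hc0 hC hε0 hlim ?_
  filter_upwards [hcosts, hthree] with n hcn hthree
  set T : Fin 2 → Set (Fin n → U) := fun h =>
    typicalSet n (φ h) (∑ z, margU (![P, Q] h) z * φ h z - η)
  set B' : Fin 2 → Set (Fin n → V) := fun h => typicalSet n (ψ h) (∑ z, margV P z * ψ h z - η)
  set Ba := typicalSet n a (∑ z, margV P z * a z - η)
  set D := typicalSet n b (∑ z, Γ 0 z * b z - η)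
  obtain ⟨A, hA⟩ : ∃ A : Set (Fin n → U), ∀ u, u ∈ A ↔ ∃ h ∈ S, u ∈ T h :=
    ⟨{u | ∃ h ∈ S, u ∈ T h}, fun _ => Iff.rfl⟩
  obtain ⟨B, hB⟩ : ∃ B : Set (Fin n → V), ∀ v, v ∈ B ↔ v ∈ B' 0 ∧ v ∈ B' 1 ∧ v ∈ Ba :=
    ⟨{v | v ∈ B' 0 ∧ v ∈ B' 1 ∧ v ∈ Ba}, fun _ => Iff.rfl⟩
  have hAc : ∀ h ∈ S, ∑ u : Fin n → U, (if u ∈ A then 0 else ∏ i, margU (![P, Q] h) (u i)) ≤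
      r h ^ n := by
    intro h hh
    refine le_trans (Finset.sum_le_sum fun u _ => ?_) (htail h n)
    have h0 := prod_word_nonneg (margU_mem_stdSimplex (hR h)) u
    by_cases hu : u ∈ T h
    · rw [if_pos ((hA u).2 ⟨h, hh, hu⟩), if_pos hu]
    · rw [if_neg (c := u ∈ typicalSet _ _ _) hu]
      split_ifs
      · exact h0
      · exact le_rfl
  refine ⟨twoWordEncoder A (fun _ => 0) (fun _ => x), rectangleDecoder B D, fun h hh => ?_, ?_, ?_⟩
  · rw [expectedCost_eq]
    refine le_trans (le_of_eq ?_) ((mul_le_mul_of_nonneg_right (hAc h hh) ?_).trans (hcn h))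
    · rw [Finset.sum_mul]
      refine Finset.sum_congr rfl fun u _ => ?_
      by_cases hu : u ∈ A <;> simp [twoWordEncoder, hu, hc0]
    · exact mul_nonneg (Nat.cast_nonneg n) hcx
  · refine (decisionProb_one_twoWord_le hΓ hP A _ _ B D).trans ?_
    refine add_le_add (add_le_add (hAc 0 hS) ?_) (htailb n)
    refine le_trans ?_ (add_le_add (add_le_add (htails 0 n) (htails 1 n)) (htaila n))
    rw [← Finset.sum_add_distrib, ← Finset.sum_add_distrib]
    refine Finset.sum_le_sum fun v _ => ?_
    have h0 := prod_word_nonneg hPV v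
    have hnn : ∀ p : Prop, 0 ≤ if p then 0 else ∏ i, margV P (v i) := fun p => by
      split_ifs
      · exact le_rfl
      · exact h0
    by_cases hv : v ∈ B
    · rw [if_pos hv]
      exact add_nonneg (add_nonneg (hnn _) (hnn _)) (hnn _)
    · rw [if_neg hv]
      have h3 : v ∉ B' 0 ∨ v ∉ B' 1 ∨ v ∉ Ba := by
        rw [hB] at hv; tauto
      rcases h3 with h3 | h3 | h3
      · rw [if_neg (c := v ∈ typicalSet _ (ψ 0) _) h3]
        linarith [hnn (v ∈ B' 1), hnn (v ∈ Ba)]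
      · rw [if_neg (c := v ∈ typicalSet _ (ψ 1) _) h3]
        linarith [hnn (v ∈ B' 0), hnn (v ∈ Ba)]
      · rw [if_neg (c := v ∈ typicalSet _ a _) h3]
        linarith [hnn (v ∈ B' 0), hnn (v ∈ B' 1)]
  · refine (decisionProb_zero_twoWord_le hΓ (fun w => (hQp w).le) A _ _ B D).trans ?_
    set bd := Real.exp (-(n * (θ + η))) with hbd
    have hQn : ∀ (u : Fin n → U) (v : Fin n → V), 0 ≤ ∏ i, Q (u i, v i) := fun u v =>
      Finset.prod_nonneg fun i _ => (hQp _).le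
    have hT1 : ∀ h, ∑ u : Fin n → U, ∑ v : Fin n → V,
        (if h ∈ S ∧ u ∈ T h ∧ v ∈ B' h then ∏ i, Q (u i, v i) else 0) ≤ bd := by
      intro h
      by_cases hh : h ∈ S
      · simp only [hh, true_and]
        refine (sum_pair_upper_tail_le (fun w => (hQp w).le) (φ h) (ψ h) (hφψ h) n).trans ?_
        rw [hbd]
        gcongr
        linarith [hη1 h hh]
      · simp [hh, hbd, Real.exp_nonneg]
    have h1 : ∑ u : Fin n → U, ∑ v : Fin n → V,
        (if u ∈ A ∧ v ∈ B then ∏ i, Q (u i, v i) else 0) ≤ bd + bd := by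
      refine le_trans ?_ (add_le_add (hT1 0) (hT1 1))
      rw [← Finset.sum_add_distrib]
      refine Finset.sum_le_sum fun u _ => ?_
      rw [← Finset.sum_add_distrib]
      refine Finset.sum_le_sum fun v _ => ?_
      have h0 := hQn u v
      have hnn : ∀ (p : Prop) [Decidable p], 0 ≤ if p then ∏ i, Q (u i, v i) else 0 := fun p _ => by
        split_ifs
        · exact h0
        · exact le_rfl
      by_cases huv : u ∈ A ∧ v ∈ B
      · obtain ⟨h, hh, hu⟩ := (hA u).1 huv.1
        have hv := (hB v).1 huv.2
        rw [if_pos huv]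
        have hcases : h = 0 ∨ h = 1 := by fin_cases h <;> simp
        rcases hcases with rfl | rfl
        · rw [if_pos (⟨hh, hu, hv.1⟩ : (0 : Fin 2) ∈ S ∧ u ∈ T 0 ∧ v ∈ B' 0)]
          exact le_add_of_nonneg_right (hnn _)
        · rw [if_pos (⟨hh, hu, hv.2.1⟩ : (1 : Fin 2) ∈ S ∧ u ∈ T 1 ∧ v ∈ B' 1)]
          exact le_add_of_nonneg_left (hnn _)
      · rw [if_neg huv]
        exact add_nonneg (hnn _) (hnn _)
    have h2 : (∑ v : Fin n → V, if v ∈ B then ∏ i, margV Q (v i) else 0) ≤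
        Real.exp (-(n * (klReal (margV P) (margV Q) - 2 * η))) := by
      have h3 := sum_upper_tail_le (n := n) (q := fun _ => margV Q) (fun _ => hQV.1) a
        (m := ∑ z, margV P z * a z - η) (z := 0) (fun _ => by simpa using ha)
      refine le_trans (Finset.sum_le_sum fun v _ => ?_) (h3.trans ?_)
      · have h0 := prod_word_nonneg hQV v
        by_cases hv : v ∈ B
        · rw [if_pos hv, if_pos (c := v ∈ typicalSet _ a _) ((hB v).1 hv).2.2]
        · rw [if_neg hv]
          split_ifs
          · exact h0
          · exact le_rfl
      · refine Real.exp_le_exp.2 (neg_le_neg (mul_le_mul_of_nonneg_left ?_ (Nat.cast_nonneg n)))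
        linarith
    have h4 : (∑ y : Fin n → Y, if y ∈ D then ∏ i, Γ x (y i) else 0) ≤
        Real.exp (-(n * (klReal (Γ 0) (Γ x) - 2 * η))) := by
      have h3 := sum_upper_tail_le (n := n) (q := fun _ => Γ x) (fun _ => (hΓ x).1) b
        (m := ∑ z, Γ 0 z * b z - η) (z := 0) (fun _ => by simpa using hb)
      refine le_trans h3 ?_
      refine Real.exp_le_exp.2 (neg_le_neg (mul_le_mul_of_nonneg_left ?_ (Nat.cast_nonneg n)))
      linarith
    have h5 : (∑ v : Fin n → V, if v ∈ B then ∏ i, margV Q (v i) else 0) *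
        (∑ y : Fin n → Y, if y ∈ D then ∏ i, Γ x (y i) else 0) ≤ bd := by
      refine (mul_le_mul h2 h4 (Finset.sum_nonneg fun y _ => ?_) (Real.exp_pos _).le).trans ?_
      · split_ifs
        · exact Finset.prod_nonneg fun i _ => (hΓ x).1 _
        · exact le_rfl
      · rw [← Real.exp_add, hbd, ← neg_add, ← mul_add]
        refine Real.exp_le_exp.2 (neg_le_neg (mul_le_mul_of_nonneg_left ?_ (Nat.cast_nonneg n)))
        linarith
    calc _ ≤ bd + bd + bd := add_le_add h1 h5
      _ = 3 * bd := by ring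
      _ ≤ Real.exp (n * η) * bd := by
          gcongr
      _ = Real.exp (-(n * θ)) := by
          rw [hbd, ← Real.exp_add]; congr 1; ring

end Achievability

/-! ### The Stein exponent -/

section Stein

theorem klReal_self {α : Type*} [Fintype α] (p : α → ℝ) : klReal p p = 0 := by
  refine Finset.sum_eq_zero fun a _ => ?_
  by_cases h : p a = 0 <;> simp [h]

variable {U V X Y : Type*} [Fintype U] [Fintype V] [Fintype Y]
  {P Q : U × V → ℝ} {Γ : X → Y → ℝ} {c : X → ℝ} {C : ℕ → ℝ} {S : Set (Fin 2)} {ε : ℝ}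

theorem steinExponent_eq_of_forall {E : ℝ≥0∞} (hE : E ≠ ⊤)
    (hupper : ∀ θ, Achievable P Q Γ c C S ε θ → θ ≤ E.toReal)
    (hlower : ∀ θ, θ < E.toReal → Achievable P Q Γ c C S ε θ) :
    steinExponent P Q Γ c C S ε = E := by
  refine le_antisymm (iSup₂_le fun θ hθ => ?_) (le_of_forall_lt fun a ha => ?_)
  · exact ENNReal.ofReal_le_of_le_toReal (hupper θ hθ.2)
  · have ha' : a ≠ ⊤ := ha.ne_top
    have hlt := (ENNReal.toReal_lt_toReal ha' hE).2 ha
    have ha0 : 0 ≤ a.toReal := ENNReal.toReal_nonneg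
    set θ := (a.toReal + E.toReal) / 2 with hθ
    refine lt_of_lt_of_le ?_ (le_iSup₂ (f := fun (θ : ℝ) (_ : θ ∈ {θ : ℝ | 0 < θ ∧
      Achievable P Q Γ c C S ε θ}) => ENNReal.ofReal θ) θ ⟨by linarith, hlower θ (by linarith)⟩)
    rw [ENNReal.lt_ofReal_iff_toReal_lt ha']
    linarith

theorem exists_exponentE2_eq [Fintype X] [Zero X] [Nontrivial X]
    (hP : P ∈ stdSimplex ℝ (U × V)) (hQ : Q ∈ stdSimplex ℝ (U × V))
    (hQV : ∀ v, 0 < margV Q v) (hΓ : ∀ x, Γ x ∈ stdSimplex ℝ Y)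
    (hac : ∀ x y, Γ x y = 0 → Γ 0 y = 0) :
    ∃ x : X, exponentE2 P Q Γ =
        ENNReal.ofReal (klReal (margV P) (margV Q) + klReal (Γ 0) (Γ x)) ∧
      ∀ z, klReal (Γ 0) (Γ z) ≤ klReal (Γ 0) (Γ x) := by
  classical
  obtain ⟨x₁, hx₁⟩ := exists_ne (0 : X)
  obtain ⟨x, hx, hmax⟩ := Finset.exists_max_image (Finset.univ.filter fun x : X => x ≠ 0)
    (fun x => klReal (Γ 0) (Γ x)) ⟨x₁, by simpa using hx₁⟩
  have hx0 : x ≠ 0 := by simpa using hx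
  have hnn : ∀ z, 0 ≤ klReal (Γ 0) (Γ z) := fun z => klReal_nonneg (hΓ 0) (hΓ z) (hac z)
  refine ⟨x, ?_, fun z => ?_⟩
  · have hsup : ⨆ z ∈ {z : X | z ≠ 0}, relEntropy (Γ 0) (Γ z) =
        ENNReal.ofReal (klReal (Γ 0) (Γ x)) := by
      refine le_antisymm (iSup₂_le fun z hz => ?_) ?_
      · rw [relEntropy_eq_ofReal (hac z)]
        exact ENNReal.ofReal_le_ofReal (hmax z (by simpa using hz))
      · rw [← relEntropy_eq_ofReal (hac x)]
        exact le_iSup₂ (f := fun (z : X) (_ : z ∈ {z : X | z ≠ 0}) => relEntropy (Γ 0) (Γ z)) x hx0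
    have hV : ∀ v, margV Q v = 0 → margV P v = 0 := fun v h => absurd h (hQV v).ne'
    rw [exponentE2, hsup, relEntropy_eq_ofReal hV, ENNReal.ofReal_add _ (hnn x)]
    exact klReal_nonneg (margV_mem_stdSimplex hP) (margV_mem_stdSimplex hQ) hV
  · by_cases hz : z = 0
    · rw [hz, klReal_self]; exact hnn x
    · exact hmax z (by simpa using hz)

end Stein

end DistDetect

open DistDetect in
theorem theorem3 {U V X Y : Type*} [Fintype U] [Fintype V] [Fintype X] [Fintype Y]
    [Zero X] [Nontrivial X]
    (P Q : U × V → ℝ) (hP : P ∈ stdSimplex ℝ (U × V)) (hQ : Q ∈ stdSimplex ℝ (U × V))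
    (hQpos : ∀ a, 0 < Q a)
    (Γ : X → Y → ℝ) (hΓ : ∀ x, Γ x ∈ stdSimplex ℝ Y)
    (c : X → ℝ) (hc : ∀ x, 0 ≤ c x) (hc0 : ∀ x, c x = 0 ↔ x = 0)
    (C : ℕ → ℝ) (hCnonneg : ∀ n, 1 ≤ n → 0 ≤ C n)
    (hCtop : Filter.Tendsto C Filter.atTop Filter.atTop)
    (hCsub : Filter.Tendsto (fun n : ℕ => C n / n) Filter.atTop (nhds 0))
    (ε : ℝ) (hε0 : 0 ≤ ε) (hε1 : ε < 1) :
    (DistDetect.PartiallyConnected Γ →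
      DistDetect.steinExponent P Q Γ c C Set.univ ε = DistDetect.exponentE1 P Q ∧
      DistDetect.steinExponent P Q Γ c C {0} ε = DistDetect.exponentE1 P Q) ∧
    (¬ DistDetect.PartiallyConnected Γ →
      DistDetect.steinExponent P Q Γ c C {0} ε =
        min (DistDetect.exponentE1 P Q) (DistDetect.exponentE2 P Q Γ) ∧
      DistDetect.steinExponent P Q Γ c C Set.univ ε =
        min (DistDetect.exponentE1 P Q)
          (min (DistDetect.exponentE2 P Q Γ) (DistDetect.exponentE3 P Q))) := by
  have hPV := margV_mem_stdSimplex hP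
  have hE1 : exponentE1 P Q ≠ ⊤ := minDivergence_ne_top (margU_mem_stdSimplex hP) hPV hQpos
  have hE3 : exponentE3 P Q ≠ ⊤ := minDivergence_ne_top (margU_mem_stdSimplex hQ) hPV hQpos
  have hcz : c 0 = 0 := (hc0 0).2 rfl
  constructor
  · intro hconn
    have key : ∀ S : Set (Fin 2), 0 ∈ S → steinExponent P Q Γ c C S ε = exponentE1 P Q :=
      fun S hS => steinExponent_eq_of_forall hE1
        (fun θ h => exponent_le_exponentE1 hP hQpos hΓ hc hc0 hCtop hCsub hε1 hS h)
        (fun θ h => achievable_of_partiallyConnected hP hQ hQpos hΓ hcz hCnonneg hCtop hε0 hconn h)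
    exact ⟨key _ (Set.mem_univ 0), key _ rfl⟩
  · intro hconn
    have hac : ∀ x y, Γ x y = 0 → Γ 0 y = 0 := fun x y h => by
      by_contra hne
      exact hconn ⟨0, x, y, lt_of_le_of_ne ((hΓ 0).1 y) (Ne.symm hne), h⟩
    have hU : Nonempty U := by
      by_contra h
      rw [not_nonempty_iff] at h
      simpa using hQ.2
    have hQV : ∀ v, 0 < margV Q v := fun v =>
      Finset.sum_pos (fun u _ => hQpos _) Finset.univ_nonempty
    obtain ⟨x, hx, hmax⟩ := exists_exponentE2_eq hP hQ hQV hΓ hac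
    have hE2 : exponentE2 P Q Γ ≠ ⊤ := by rw [hx]; exact ENNReal.ofReal_ne_top
    have hE2r : (exponentE2 P Q Γ).toReal = klReal (margV P) (margV Q) + klReal (Γ 0) (Γ x) := by
      rw [hx, ENNReal.toReal_ofReal]
      exact add_nonneg (klReal_nonneg hPV (margV_mem_stdSimplex hQ)
        fun v h => absurd h (hQV v).ne') (klReal_nonneg (hΓ 0) (hΓ x) (hac x))
    have hupper : ∀ S : Set (Fin 2), 0 ∈ S → ∀ θ, Achievable P Q Γ c C S ε θ →
        θ ≤ (exponentE2 P Q Γ).toReal := by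
      intro S hS θ hach
      rw [hE2r]
      refine le_of_forall_pos_le_add fun η hη => ?_
      exact exponent_le_of_klReal_lt hP hQ hQpos hΓ hc hc0 hCtop hCsub hε1 hS hconn
        (t₁ := klReal (margV P) (margV Q) + η / 3) (t₂ := klReal (Γ 0) (Γ x) + η / 3)
        (by linarith) (fun z => by linarith [hmax z]) (by linarith) hach
    have hz : (0 : Fin 2) ∈ ({0} : Set (Fin 2)) := Set.mem_singleton 0
    constructor
    · refine steinExponent_eq_of_forall (by simp [hE1]) (fun θ hach => ?_) fun θ hθ => ?_
      · rw [ENNReal.toReal_min hE1 hE2]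
        exact le_min (exponent_le_exponentE1 hP hQpos hΓ hc hc0 hCtop hCsub hε1 hz hach)
          (hupper _ hz θ hach)
      · rw [ENNReal.toReal_min hE1 hE2, lt_min_iff, hE2r] at hθ
        exact achievable_of_lt hP hQ hQpos hΓ hcz hCnonneg hCtop hε0 hz
          (fun h hh => by rw [Set.mem_singleton_iff.1 hh]; exact hθ.1) (hc x) (hac x) hθ.2
    · have hE23 : min (exponentE2 P Q Γ) (exponentE3 P Q) ≠ ⊤ := by simp [hE3]
      have h0 : (0 : Fin 2) ∈ (Set.univ : Set (Fin 2)) := Set.mem_univ 0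
      refine steinExponent_eq_of_forall (by simp [hE1]) (fun θ hach => ?_) fun θ hθ => ?_
      · rw [ENNReal.toReal_min hE1 hE23, ENNReal.toReal_min hE2 hE3]
        exact le_min (exponent_le_exponentE1 hP hQpos hΓ hc hc0 hCtop hCsub hε1 h0 hach)
          (le_min (hupper _ h0 θ hach) (exponent_le_of_fullyConnected (h := 1) hP hQpos hΓ hc hc0
            hCtop hCsub hε0 hε1 h0 hconn (Set.mem_univ _) hQ hach))
      · rw [ENNReal.toReal_min hE1 hE23, ENNReal.toReal_min hE2 hE3, lt_min_iff, lt_min_iff,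
          hE2r] at hθ
        refine achievable_of_lt hP hQ hQpos hΓ hcz hCnonneg hCtop hε0 h0 (fun h _ => ?_) (hc x)
          (hac x) hθ.2.1
        fin_cases h
        · exact hθ.1
        · exact hθ.2.2
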